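/- For complex $a_i,c_j$, none of the $c_j$ being zero or a negative integer, let $${}_rF_s(a_1,\dots,a_r;c_1,\dots,c_s;z)=\sum_{k=0}^\infty\frac{(a_1)_k\cdots(a_r)_k}{(c_1)_k\cdots(c_s)_k\,k!}z^k ,\qquad (a)_k=a(a+1)\cdots(a+k-1).$$ Let $$\mathcal W_{p,b,c}(z)=\sum_{k=0}^{\infty}\frac{(-1)^kc^k}{\Gamma\left(p+\frac{b+1}{2}+k\right)k!}\left(\frac z2\right)^{2k+p}$$ be the generalized Bessel function of the first kind. For $x>0$ let $$\left(I_{0,+}^{\alpha,\alpha',\beta,\beta',\gamma}f\right)(x)=\frac{x^{-\alpha}}{\Gamma(\gamma)}\int_0^x(x-t)^{\gamma-1}t^{-\alpha'}F_3\left(\alpha,\alpha',\beta,\beta';\gamma;1-\frac tx,1-\frac xt\right)f(t)\,dt$$ be the left-sided Marichev–Saigo–Maeda fractional integral, where $F_3$ is Appell's function $$F_3(\alpha,\alpha',\beta,\beta';\gamma;u,v)=\sum_{m,n\ge0}\frac{(\alpha)_m(\alpha')_n(\beta)_m(\beta')_n}{(\gamma)_{m+n}\,m!\,n!}u^mv^n\qquad(|u|,|v|<1),$$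 continued analytically in $v$, for fixed $|u|<1$, to $\{|v|<1\}\cup\{\operatorname{Re}v<1/2\}$ (in particular to all $v<0$). **Theorem.** Let $\alpha,\alpha',\beta,\beta',\gamma,\rho,p,b,c\in\mathbb C$ be such that $\kappa:=p+\frac{b+1}2\ne0,-1,-2,\dots$, $\operatorname{Re}(\gamma)>0$ and $$\operatorname{Re}(\rho+p)>\max\{0,\operatorname{Re}(\alpha+\alpha'+\beta-\gamma),\operatorname{Re}(\alpha'-\beta')\}.$$ Suppose that none of $\rho+p+\beta'$, $\rho+p+\gamma-\alpha-\alpha'$, $\rho+p+\gamma-\alpha'-\beta$ is zero or a negative integer (so that the function ${}_6F_7$ below is defined). Then for every $x>0$ the integral defining the left-hand side below converges absolutely, and $$\left(I_{0,+}^{\alpha,\alpha',\beta,\beta',\gamma}\,t^{\rho-1}\mathcal W_{p,b,c}(t)\right)(x)=\frac{x^{\rho+p-\alpha-\alpha'+\gamma-1}}{2^p}\,\frac{\Gamma(\rho+p)\,\Gamma(\rho+p+\gamma-\alpha-\alpha'-\beta)\,\Gamma(\rho+p+\beta'-\alpha')}{\Gamma(\rho+p+\beta')\,\Gamma(\rho+p+\gamma-\alpha-\alpha')\,\Gamma(\rho+p+\gamma-\alpha'-\beta)\,\Gamma(\kappa)}$$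 $$\times\;{}_6F_7\left[\begin{array}{l}\frac{\rho+p}2,\ \frac{\rho+p+1}2,\ \frac{\rho+p+\gamma-\alpha-\alpha'-\beta}2,\ \frac{\rho+p+\gamma-\alpha-\alpha'-\beta+1}2,\ \frac{\rho+p+\beta'-\alpha'}2,\ \frac{\rho+p+\beta'-\alpha'+1}2;\\ \kappa,\ \frac{\rho+p+\beta'}2,\ \frac{\rho+p+\beta'+1}2,\ \frac{\rho+p+\gamma-\alpha-\alpha'}2,\ \frac{\rho+p+\gamma-\alpha-\alpha'+1}2,\ \frac{\rho+p+\gamma-\alpha'-\beta}2,\ \frac{\rho+p+\gamma-\alpha'-\beta+1}2\end{array}\Big|-\frac{cx^2}4\right].$$ -/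

import Mathlib

noncomputable section

/-- The Pochhammer symbol `(a)_k = a (a + 1) ⋯ (a + k - 1)`. -/
def poch (a : ℂ) (k : ℕ) : ℂ := (ascPochhammer ℂ k).eval a

/-- The generalized Bessel function of the first kind
`W_{p,b,c}(z) = ∑ₖ (-1)ᵏ cᵏ / (Γ(p + (b+1)/2 + k) k!) (z/2)^(2k+p)` (principal powers). -/
def besselW (p b c z : ℂ) : ℂ :=
  ∑' k : ℕ, (-1) ^ k * c ^ k / (Complex.Gamma (p + (b + 1) / 2 + k) * (k.factorial : ℂ)) *
    (z / 2) ^ (2 * (k : ℂ) + p)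

/-- The generalized hypergeometric series `ₚF_q(a₁,…,aₚ; c₁,…,c_q; z)`, the parameters being
given as lists. -/
def genHypergeometric (a c : List ℂ) (z : ℂ) : ℂ :=
  ∑' k : ℕ, (a.map fun s => poch s k).prod / ((c.map fun s => poch s k).prod * poch 1 k) * z ^ k

/-- The terms of the double power series of Appell's function `F₃(a, a', b, b'; c; u, v)`. -/
def appellF3Term (a a' b b' c u v : ℂ) (i : ℕ × ℕ) : ℂ :=
  poch a i.1 * poch a' i.2 * poch b i.1 * poch b' i.2 /
    (poch c (i.1 + i.2) * (i.1.factorial : ℂ) * (i.2.factorial : ℂ)) * u ^ i.1 * v ^ i.2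

/-- A domain in the `v`-plane cut along `[1, ∞)`: the union of the unit disc, where the double
series of `F₃` converges (for `|u| < 1`), and of a half-plane containing the negative real axis. -/
def appellF3Domain : Set ℂ := {v | ‖v‖ < 1} ∪ {v | v.re < 1 / 2}

/-- `F` is, for the given `u`, the analytic continuation of `v ↦ F₃(a, a', b, b'; c; u, v)` from
the unit disc, where it is the sum of the double series, to `appellF3Domain`. -/
def IsAppellF3Continuation (a a' b b' c u : ℂ) (F : ℂ → ℂ) : Prop :=
  DifferentiableOn ℂ F appellF3Domain ∧
    ∀ v : ℂ, ‖v‖ < 1 → HasSum (appellF3Term a a' b b' c u v) (F v)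

/-- The analytic continuation is unique. -/
theorem IsAppellF3Continuation.eqOn {a a' b b' c u : ℂ} {F G : ℂ → ℂ}
    (hF : IsAppellF3Continuation a a' b b' c u F) (hG : IsAppellF3Continuation a a' b b' c u G) :
    Set.EqOn F G appellF3Domain := by
  have hball : {v : ℂ | ‖v‖ < 1} = Metric.ball 0 1 := by
    ext v
    simp
  have hopen : IsOpen appellF3Domain :=
    (isOpen_lt continuous_norm continuous_const).union
      (isOpen_lt Complex.continuous_re continuous_const)
  have hconn : IsPreconnected appellF3Domain := by
    refine IsPreconnected.union (0 : ℂ) (by simp) (by simp) ?_ ?_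
    · rw [hball]
      exact (convex_ball _ _).isPreconnected
    · exact (convex_halfSpace_re_lt _).isPreconnected
  refine (hF.1.analyticOnNhd hopen).eqOn_of_preconnected_of_eventuallyEq
    (hG.1.analyticOnNhd hopen) hconn (z₀ := 0) (Or.inl (by simp)) ?_
  filter_upwards [Metric.ball_mem_nhds (0 : ℂ) one_pos] with v hv
  have hv' : ‖v‖ < 1 := by simpa using hv
  exact (hF.2 v hv').unique (hG.2 v hv')

open Classical in
/-- Appell's function `F₃(a, a', b, b'; c; u, v)` for `|u| < 1` and `v` in `appellF3Domain`:
the sum of the double series for `|v| < 1`, and its analytic continuation in `v` elsewhere. -/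
def appellF3 (a a' b b' c u v : ℂ) : ℂ :=
  if h : ∃ F : ℂ → ℂ, IsAppellF3Continuation a a' b b' c u F then h.choose v else 0

/-- `appellF3` is computed by any analytic continuation. -/
theorem IsAppellF3Continuation.appellF3_eq {a a' b b' c u : ℂ} {F : ℂ → ℂ}
    (hF : IsAppellF3Continuation a a' b b' c u F) {v : ℂ} (hv : v ∈ appellF3Domain) :
    appellF3 a a' b b' c u v = F v := by
  have h : ∃ F : ℂ → ℂ, IsAppellF3Continuation a a' b b' c u F := ⟨F, hF⟩
  rw [appellF3, dif_pos h]
  exact h.choose_spec.eqOn hF hv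

/-- The integrand of the left-sided Marichev-Saigo-Maeda operator. -/
def msmIntegrand (α α' β β' γ : ℂ) (f : ℝ → ℂ) (x t : ℝ) : ℂ :=
  ((x - t : ℝ) : ℂ) ^ (γ - 1) * (t : ℂ) ^ (-α') *
    appellF3 α α' β β' γ ((1 - t / x : ℝ) : ℂ) ((1 - x / t : ℝ) : ℂ) * f t

/-- The left-sided Marichev-Saigo-Maeda fractional integral
`(I_{0,+}^{α,α',β,β',γ} f)(x) = x^(-α)/Γ(γ) ∫₀ˣ (x-t)^(γ-1) t^(-α') F₃(…; 1-t/x, 1-x/t) f(t) dt`. -/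
def msmIntegral (α α' β β' γ : ℂ) (f : ℝ → ℂ) (x : ℝ) : ℂ :=
  (x : ℂ) ^ (-α) / Complex.Gamma γ * ∫ t in (0 : ℝ)..x, msmIntegrand α α' β β' γ f x t

end

/-!
Both sides are sums over `k` of the Bessel series, so everything rests on one Mellin transform. With
`t = x y` and `0 < y < 1`, the arguments of `F₃` are `u = 1 - y` and `v = 1 - 1 / y`, so that
`v / (v - 1) = u`. Applying Pfaff's transformation to the inner sums of `F₃` continues it to
`Re v < 1 / 2` (`appellF3_eq_kernelSeries`) and turns `y ^ (-α') F₃` into a power series in `1 - y`,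
namely `∑ (α)ₘ (β)ₘ (α')ₙ (γ + m - β')ₙ / ((γ)ₘ₊ₙ m! n!) (1 - y) ^ (m + n)` (`kernelSeries`).

The Mellin transform of `(1 - y) ^ (γ - 1)` times this series is the quotient of Gamma functions
`mellinValue` (`mellinKernel_integral`). When `1 ≤ Re α'`, the series of beta integrals converges
absolutely on the whole half-plane of the theorem, and it is summed by Gauss's theorem, first over
`n` and then over `m`; Gauss's theorem is needed in the regularized form `hasSum_gaussTerm`, since
the lower parameter of the outer sum may be a pole of `Γ`. For smaller `Re α'` the
series of absolute values diverges for some admissible `s`, although the integral does not. There a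
contiguous relation (`kernelSeries_contiguous`) writes the kernel in terms of two kernels with `α'`
raised by `1`; both have admissible parameters again, and `mellinValue` satisfies the same relation,
so the formula and the integrability descend by induction.

Finally, `W` is integrated term by term (`integral_mellinKernel_mul_besselW`): the `k`-th term gives
the Mellin transform at `s = ρ + p + 2 k`, and the duplication
`(a)₂ₖ = 4 ^ k (a / 2)ₖ ((a + 1) / 2)ₖ` produces the parameters of `₆F₇`. All convergence statements
come from one bound on Pochhammer quotients, `exists_norm_poch_div_poch_le`.
-/

/-! ### Pochhammer symbols -/

@[simp]
theorem poch_zero (a : ℂ) : poch a 0 = 1 := by simp [poch]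

theorem poch_succ (a : ℂ) (n : ℕ) : poch a (n + 1) = poch a n * (a + n) :=
  ascPochhammer_succ_eval n a

theorem poch_add (a : ℂ) (m n : ℕ) : poch a (m + n) = poch a m * poch (a + m) n := by
  induction n with
  | zero => simp
  | succ n ih =>
    rw [← add_assoc, poch_succ, ih, poch_succ]
    push_cast
    ring

theorem poch_succ_left (a : ℂ) (n : ℕ) : poch a (n + 1) = a * poch (a + 1) n := by
  have h := poch_add a 1 n
  have h1 : poch a 1 = a := by simpa using poch_succ a 0
  rw [add_comm, h, h1]
  simp

theorem poch_one (n : ℕ) : poch 1 n = (n.factorial : ℂ) := by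
  simp [poch]

theorem poch_ne_zero {a : ℂ} (ha : ∀ n : ℕ, a ≠ -(n : ℂ)) (n : ℕ) : poch a n ≠ 0 := by
  induction n with
  | zero => simp
  | succ n ih =>
    rw [poch_succ]
    exact mul_ne_zero ih fun h => ha n (eq_neg_of_add_eq_zero_left h)

theorem ne_neg_nat_of_re_pos {a : ℂ} (ha : 0 < a.re) (n : ℕ) : a ≠ -(n : ℂ) := by
  rintro rfl
  simp only [Complex.neg_re, Complex.natCast_re] at ha
  have := n.cast_nonneg (α := ℝ)
  linarith

theorem add_nat_ne_neg_nat {a : ℂ} (ha : ∀ n : ℕ, a ≠ -(n : ℂ)) (m n : ℕ) :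
    a + m ≠ -(n : ℂ) := by
  intro h
  apply ha (m + n)
  push_cast
  linear_combination h

theorem Gamma_add_nat_eq_poch {a : ℂ} (ha : ∀ n : ℕ, a ≠ -(n : ℂ)) (n : ℕ) :
    Complex.Gamma (a + n) = poch a n * Complex.Gamma a := by
  rw [poch, ← Complex.Gamma_add_nat_div_Gamma_eq a ha,
    div_mul_cancel₀ _ (Complex.Gamma_ne_zero ha)]

theorem poch_two_mul (a : ℂ) (k : ℕ) :
    poch a (2 * k) = 4 ^ k * (poch (a / 2) k * poch ((a + 1) / 2) k) := by
  induction k with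
  | zero => simp
  | succ k ih =>
    rw [mul_add, mul_one, ← add_assoc (2 * k) 1 1, poch_succ, poch_succ, ih, poch_succ, poch_succ]
    push_cast
    ring

/-! ### Growth of Pochhammer quotients -/

/-- One factor of a Pochhammer quotient, compared with the growth of a power of `j + 1`; the
exponential error factors have a convergent product. -/
theorem exists_norm_add_div_add_le (a b : ℂ) (hb : ∀ n : ℕ, b ≠ -(n : ℂ)) :
    ∃ C : ℝ, 0 ≤ C ∧ ∀ j : ℕ, ‖(a + j) / (b + j)‖ ≤
      (((j : ℝ) + 2) / (j + 1)) ^ (a - b).re * Real.exp (C / ((j : ℝ) + 1) ^ 2) := by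
  have hb0 : ∀ j : ℕ, b + j ≠ 0 := fun j h => hb j (eq_neg_of_add_eq_zero_left h)
  obtain ⟨K, hK⟩ : ∃ K : ℝ, ∀ j : ℕ, ‖((j : ℂ) + 1) / (b + j)‖ ≤ K := by
    have h1 : Filter.Tendsto (fun j : ℕ => ((j : ℂ) + 1) / (b + j)) Filter.atTop (nhds (1 / 1)) := by
      have h := tendsto_inv_atTop_nhds_zero_nat (𝕜 := ℂ)
      have h2 : Filter.Tendsto (fun j : ℕ => (1 + (j : ℂ)⁻¹) / (b * (j : ℂ)⁻¹ + 1)) Filter.atTop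
          (nhds ((1 + 0) / (b * 0 + 1))) :=
        (tendsto_const_nhds.add h).div ((tendsto_const_nhds.mul h).add tendsto_const_nhds) (by simp)
      simp only [add_zero, mul_zero, zero_add] at h2
      refine h2.congr' ?_
      filter_upwards [Filter.eventually_gt_atTop 0] with j hj
      have hj' : (j : ℂ) ≠ 0 := by exact_mod_cast hj.ne'
      rw [← mul_div_mul_right _ _ hj']
      congr 1 <;> field_simp
    obtain ⟨K, hK⟩ := h1.norm.bddAbove_range
    exact ⟨K, fun j => hK ⟨j, rfl⟩⟩
  have hK0 : 0 ≤ K := (norm_nonneg _).trans (hK 0)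
  refine ⟨‖a - b‖ * ‖1 - b‖ * K + |(a - b).re| + (‖a - b‖ * K) ^ 2 / 2, by positivity, fun j => ?_⟩
  set y : ℝ := 1 / ((j : ℝ) + 1) with hy
  have hj1 : (0 : ℝ) < (j : ℝ) + 1 := by positivity
  have hy0 : 0 < y := by positivity
  have hyC : ((y : ℝ) : ℂ) * ((j : ℂ) + 1) = 1 := by
    rw [hy]
    have : (j : ℂ) + 1 ≠ 0 := by exact_mod_cast hj1.ne'
    push_cast
    field_simp
  set q : ℂ := ((j : ℂ) + 1) / (b + j) with hq
  have hqK : ‖q‖ ≤ K := hK j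
  -- The quotient is `1 + z` with `z = (a - b) / (j + 1) + O(1 / (j + 1) ^ 2)`, and
  -- `|1 + z| ≤ exp (Re z + |z| ^ 2 / 2)`.
  set z : ℂ := (a - b) * y * q with hz
  have hz1 : (a + j) / (b + j) = 1 + z := by
    rw [hz, hq, div_eq_iff (hb0 j)]
    have := hb0 j
    field_simp
    linear_combination (b - a) * hyC
  have hz2 : z = (a - b) * y + (a - b) * (1 - b) * q * y ^ 2 := by
    have hqb : q * (b + j) = (j : ℂ) + 1 := div_mul_cancel₀ _ (hb0 j)
    rw [hz]
    linear_combination (a - b) * y * ((1 - q) * hyC + y * hqb)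
  have hre : z.re ≤ (a - b).re * y + ‖a - b‖ * ‖1 - b‖ * K * y ^ 2 := by
    rw [hz2, Complex.add_re, Complex.re_mul_ofReal]
    gcongr
    refine (Complex.re_le_norm _).trans ?_
    rw [norm_mul, norm_mul, norm_mul, norm_pow, Complex.norm_real, Real.norm_of_nonneg hy0.le]
    gcongr
  have hnorm : ‖z‖ ^ 2 ≤ (‖a - b‖ * K) ^ 2 * y ^ 2 := by
    rw [← mul_pow]
    gcongr
    rw [hz, norm_mul, norm_mul, Complex.norm_real, Real.norm_of_nonneg hy0.le]
    calc ‖a - b‖ * y * ‖q‖ ≤ ‖a - b‖ * y * K := by gcongr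
      _ = _ := by ring
  have hexp : ‖1 + z‖ ≤ Real.exp (z.re + ‖z‖ ^ 2 / 2) := by
    refine abs_le_of_sq_le_sq' ?_ (Real.exp_pos _).le |>.2
    rw [← Real.exp_nat_mul]
    have h1 : ‖1 + z‖ ^ 2 = 1 + 2 * z.re + ‖z‖ ^ 2 := by
      rw [Complex.sq_norm, Complex.sq_norm, Complex.normSq_apply, Complex.normSq_apply]
      simp
      ring
    rw [h1]
    refine le_trans (le_of_eq ?_) (Real.add_one_le_exp _)
    push_cast
    ring
  have hlog : (((j : ℝ) + 2) / (j + 1)) = 1 + y := by rw [hy]; field_simp; ring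
  have hup : Real.log (1 + y) ≤ y := by
    have := Real.log_le_sub_one_of_pos (show 0 < 1 + y by positivity)
    linarith
  have hlo : y - y ^ 2 ≤ Real.log (1 + y) := by
    refine le_trans ?_ (Real.one_sub_inv_le_log_of_pos (show 0 < 1 + y by positivity))
    rw [← sub_nonneg]
    have : 1 - (1 + y)⁻¹ - (y - y ^ 2) = y ^ 3 * (1 + y)⁻¹ := by field_simp; ring
    rw [this]
    positivity
  have hr : (a - b).re * y ≤ (a - b).re * Real.log (1 + y) + |(a - b).re| * y ^ 2 := by
    have h1 : (a - b).re * (y - Real.log (1 + y)) ≤ |(a - b).re| * (y - Real.log (1 + y)) :=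
      mul_le_mul_of_nonneg_right (le_abs_self _) (by linarith)
    have h2 : |(a - b).re| * (y - Real.log (1 + y)) ≤ |(a - b).re| * y ^ 2 :=
      mul_le_mul_of_nonneg_left (by linarith) (abs_nonneg _)
    linarith
  rw [hz1, hlog, Real.rpow_def_of_pos (by positivity), ← Real.exp_add]
  refine hexp.trans (Real.exp_le_exp.2 ?_)
  have hyy : (‖a - b‖ * ‖1 - b‖ * K + |(a - b).re| + (‖a - b‖ * K) ^ 2 / 2) / ((j : ℝ) + 1) ^ 2 =
      (‖a - b‖ * ‖1 - b‖ * K + |(a - b).re| + (‖a - b‖ * K) ^ 2 / 2) * y ^ 2 := by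
    rw [hy]; field_simp
  rw [hyy]
  linarith

/-- `(a + m)_n / (b + m)_n` is at most of the order of `((m + n + 1) / (m + 1)) ^ Re (a - b)`,
uniformly in `m` and `n`. -/
theorem exists_norm_poch_div_poch_le (a b : ℂ) (hb : ∀ n : ℕ, b ≠ -(n : ℂ)) :
    ∃ C : ℝ, 0 < C ∧ ∀ m n : ℕ, ‖poch (a + m) n / poch (b + m) n‖ ≤
      C * (((m : ℝ) + n + 1) ^ (a - b).re * ((m : ℝ) + 1) ^ (-(a - b).re)) := by
  obtain ⟨C, hC, h⟩ := exists_norm_add_div_add_le a b hb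
  have hsum : Summable fun j : ℕ => C / ((j : ℝ) + 1) ^ 2 := by
    have h1 : Summable fun j : ℕ => 1 / ((j + 1 : ℕ) : ℝ) ^ 2 :=
      (summable_nat_add_iff (f := fun j : ℕ => 1 / (j : ℝ) ^ 2) 1).2
        (Real.summable_one_div_nat_pow.2 one_lt_two)
    refine (h1.mul_left C).congr fun j => ?_
    push_cast
    ring
  refine ⟨Real.exp (∑' j : ℕ, C / ((j : ℝ) + 1) ^ 2), Real.exp_pos _, fun m n => ?_⟩
  have key : ‖poch (a + m) n / poch (b + m) n‖ ≤
      Real.exp (∑ j ∈ Finset.range n, C / ((j : ℝ) + 1) ^ 2) *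
        (((m : ℝ) + n + 1) ^ (a - b).re * ((m : ℝ) + 1) ^ (-(a - b).re)) := by
    induction n with
    | zero =>
      simp [← Real.rpow_add (show (0 : ℝ) < (m : ℝ) + 1 by positivity)]
    | succ n ih =>
      have h1 := h (m + n)
      rw [poch_succ, poch_succ, mul_div_mul_comm, norm_mul, Finset.sum_range_succ, Real.exp_add]
      have h2 : Real.exp (C / (((m + n : ℕ) : ℝ) + 1) ^ 2) ≤ Real.exp (C / ((n : ℝ) + 1) ^ 2) := by
        gcongr
        simp
      have h3 : (a + m + n) / (b + m + n) = (a + (m + n : ℕ)) / (b + (m + n : ℕ)) := by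
        push_cast
        simp only [add_assoc]
      rw [h3]
      have h4 : (((m + n : ℕ) : ℝ) + 2) / (((m + n : ℕ) : ℝ) + 1) =
          ((m : ℝ) + (n + 1 : ℕ) + 1) / ((m : ℝ) + n + 1) := by
        push_cast; ring_nf
      rw [h4, Real.div_rpow (by positivity) (by positivity)] at h1
      refine (mul_le_mul ih h1 (norm_nonneg _) (by positivity)).trans ?_
      have hp : (0 : ℝ) < ((m : ℝ) + n + 1) ^ (a - b).re := by positivity
      calc _ = Real.exp (∑ j ∈ Finset.range n, C / ((j : ℝ) + 1) ^ 2) *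
            Real.exp (C / (((m + n : ℕ) : ℝ) + 1) ^ 2) *
            (((m : ℝ) + (n + 1 : ℕ) + 1) ^ (a - b).re * ((m : ℝ) + 1) ^ (-(a - b).re)) := by
            field_simp
        _ ≤ _ := by gcongr
  refine key.trans ?_
  gcongr
  exact hsum.sum_le_tsum _ fun _ _ => by positivity

theorem exists_norm_poch_div_poch_zero_le (a b : ℂ) (hb : ∀ n : ℕ, b ≠ -(n : ℂ)) :
    ∃ C : ℝ, 0 < C ∧ ∀ n : ℕ, ‖poch a n / poch b n‖ ≤ C * ((n : ℝ) + 1) ^ (a - b).re := by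
  obtain ⟨C, hC, h⟩ := exists_norm_poch_div_poch_le a b hb
  exact ⟨C, hC, fun n => by simpa using h 0 n⟩

theorem exists_norm_poch_div_factorial_le (a : ℂ) :
    ∃ C : ℝ, 0 < C ∧ ∀ n : ℕ, ‖poch a n / (n.factorial : ℂ)‖ ≤ C * ((n : ℝ) + 1) ^ (a.re - 1) := by
  obtain ⟨C, hC, h⟩ := exists_norm_poch_div_poch_zero_le a 1 (ne_neg_nat_of_re_pos (by simp))
  exact ⟨C, hC, fun n => by simpa [poch_one] using h n⟩

/-! ### Summability of powers and geometric sequences -/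

theorem summable_nat_add_one_rpow {e : ℝ} (he : e < -1) :
    Summable fun n : ℕ => ((n : ℝ) + 1) ^ e := by
  have h := (summable_nat_add_iff (f := fun n : ℕ => (n : ℝ) ^ e) 1).2 (Real.summable_nat_rpow.2 he)
  simpa using h

theorem summable_rpow_mul_geometric (e : ℝ) {r : ℝ} (hr0 : 0 ≤ r) (hr : r < 1) :
    Summable fun n : ℕ => ((n : ℝ) + 1) ^ e * r ^ n := by
  obtain ⟨k, hk⟩ := exists_nat_ge e
  have h1 : Summable fun n : ℕ => ((n : ℝ) + 1) ^ k * r ^ n := by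
    rcases hr0.eq_or_lt with rfl | hr0'
    · refine summable_of_ne_finset_zero (s := {0}) fun n hn => ?_
      simp at hn
      simp [hn]
    · have h2 := ((summable_nat_add_iff (f := fun n : ℕ => (n : ℝ) ^ k * r ^ n) 1).2
        (summable_pow_mul_geometric_of_norm_lt_one k
          (show ‖r‖ < 1 by rwa [Real.norm_of_nonneg hr0]))).mul_right r⁻¹
      refine h2.congr fun n => ?_
      push_cast
      rw [pow_succ]
      field_simp
  refine h1.of_nonneg_of_le (fun n => by positivity) fun n => ?_
  gcongr
  rw [← Real.rpow_natCast]
  exact Real.rpow_le_rpow_of_exponent_le (by linarith [n.cast_nonneg (α := ℝ)]) hk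

theorem add_add_one_rpow_le (m n : ℕ) (e : ℝ) :
    ((m : ℝ) + n + 1) ^ e ≤ ((m : ℝ) + 1) ^ |e| * ((n : ℝ) + 1) ^ |e| := by
  have hm := m.cast_nonneg (α := ℝ)
  have hn := n.cast_nonneg (α := ℝ)
  calc ((m : ℝ) + n + 1) ^ e ≤ ((m : ℝ) + n + 1) ^ |e| :=
        Real.rpow_le_rpow_of_exponent_le (by linarith) (le_abs_self e)
    _ ≤ (((m : ℝ) + 1) * ((n : ℝ) + 1)) ^ |e| := by
        gcongr
        nlinarith
    _ = _ := Real.mul_rpow (by positivity) (by positivity)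

/-! ### Gauss's summation theorem -/

/-- The terms of the regularized Gauss series `₂F₁(a, b; c; 1) / Γ(c)`, which make sense for
every `c` because `1 / Γ` is entire: the inverse of the junk value `Γ(-n) = 0` is the right one. -/
noncomputable def gaussTerm (a b c : ℂ) (m : ℕ) : ℂ :=
  poch a m * poch b m / (m.factorial : ℂ) * (Complex.Gamma (c + m))⁻¹

theorem inv_Gamma_eq_mul_inv_Gamma_add_one (s : ℂ) :
    (Complex.Gamma s)⁻¹ = s * (Complex.Gamma (s + 1))⁻¹ :=
  Complex.one_div_Gamma_eq_self_mul_one_div_Gamma_add_one s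

theorem exists_norm_factorial_mul_inv_Gamma_le (c : ℂ) :
    ∃ C : ℝ, 0 < C ∧ ∀ m : ℕ, ‖(m.factorial : ℂ) * (Complex.Gamma (c + m))⁻¹‖ ≤
      C * ((m : ℝ) + 1) ^ (1 - c.re) := by
  obtain ⟨k, hk⟩ := exists_nat_gt (-c.re)
  induction k generalizing c with
  | zero =>
    have hc : ∀ n : ℕ, c ≠ -(n : ℂ) := ne_neg_nat_of_re_pos (by simpa using hk)
    obtain ⟨C, hC, h⟩ := exists_norm_poch_div_poch_zero_le 1 c hc
    have hG : 0 < ‖(Complex.Gamma c)⁻¹‖ := norm_pos_iff.2 (inv_ne_zero (Complex.Gamma_ne_zero hc))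
    refine ⟨C * ‖(Complex.Gamma c)⁻¹‖, by positivity, fun m => ?_⟩
    have h1 : (m.factorial : ℂ) * (Complex.Gamma (c + m))⁻¹ =
        poch 1 m / poch c m * (Complex.Gamma c)⁻¹ := by
      rw [Gamma_add_nat_eq_poch hc, poch_one]
      ring
    rw [h1, norm_mul]
    have := h m
    simp only [Complex.sub_re, Complex.one_re] at this
    calc _ ≤ (C * ((m : ℝ) + 1) ^ (1 - c.re)) * ‖(Complex.Gamma c)⁻¹‖ := by gcongr
      _ = _ := by ring
  | succ k ih =>
    obtain ⟨C, hC, h⟩ := ih (c + 1) (by simp; push_cast at hk; linarith)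
    refine ⟨(‖c‖ + 1) * C, by positivity, fun m => ?_⟩
    have h1 := h m
    rw [inv_Gamma_eq_mul_inv_Gamma_add_one, mul_left_comm, norm_mul,
      show c + m + 1 = c + 1 + m by ring]
    have h2 : ‖c + m‖ ≤ (‖c‖ + 1) * ((m : ℝ) + 1) := by
      refine (norm_add_le _ _).trans ?_
      rw [Complex.norm_natCast]
      nlinarith [norm_nonneg c, m.cast_nonneg (α := ℝ)]
    refine (mul_le_mul h2 h1 (norm_nonneg _) (by positivity)).trans (le_of_eq ?_)
    have h3 : ((m : ℝ) + 1) ^ (1 - c.re) = ((m : ℝ) + 1) * ((m : ℝ) + 1) ^ (1 - (c + 1).re) := by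
      conv_rhs => enter [1]; rw [← Real.rpow_one ((m : ℝ) + 1)]
      rw [← Real.rpow_add (by positivity)]
      congr 1
      simp
      ring
    rw [h3]
    ring

theorem exists_norm_gaussTerm_le (a b c : ℂ) :
    ∃ C : ℝ, 0 < C ∧ ∀ m : ℕ, ‖gaussTerm a b c m‖ ≤ C * ((m : ℝ) + 1) ^ ((a + b - c).re - 1) := by
  obtain ⟨A, hA, ha⟩ := exists_norm_poch_div_factorial_le a
  obtain ⟨B, hB, hb⟩ := exists_norm_poch_div_factorial_le b
  obtain ⟨C, hC, hc⟩ := exists_norm_factorial_mul_inv_Gamma_le c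
  refine ⟨A * B * C, by positivity, fun m => ?_⟩
  have hm : (0 : ℝ) < (m : ℝ) + 1 := by positivity
  have hf : (m.factorial : ℂ) ≠ 0 := by exact_mod_cast m.factorial_ne_zero
  have h1 : gaussTerm a b c m = poch a m / (m.factorial : ℂ) * (poch b m / (m.factorial : ℂ)) *
      ((m.factorial : ℂ) * (Complex.Gamma (c + m))⁻¹) := by
    rw [gaussTerm]
    field_simp
  rw [h1, norm_mul, norm_mul]
  refine (mul_le_mul (mul_le_mul (ha m) (hb m) (norm_nonneg _) (by positivity)) (hc m)
    (norm_nonneg _) (by positivity)).trans (le_of_eq ?_)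
  have h2 : (a + b - c).re - 1 = (a.re - 1) + (b.re - 1) + (1 - c.re) := by simp; ring
  rw [h2, Real.rpow_add hm, Real.rpow_add hm]
  ring

theorem summable_gaussTerm {a b c : ℂ} (h : 0 < (c - a - b).re) :
    Summable (gaussTerm a b c) := by
  obtain ⟨C, -, hC⟩ := exists_norm_gaussTerm_le a b c
  refine Summable.of_norm_bounded ((summable_nat_add_one_rpow ?_).mul_left C) hC
  simp at h ⊢
  linarith

/-- The contiguous relation in `c`, from the telescoping of `m * gaussTerm a b c m`. -/
theorem tsum_gaussTerm_contiguous {a b c : ℂ} (h : 0 < (c - a - b).re) :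
    (c - a - b) * ∑' m, gaussTerm a b c m =
      (c - a) * (c - b) * ∑' m, gaussTerm a b (c + 1) m := by
  have hs := summable_gaussTerm h
  have hs' : Summable (gaussTerm a b (c + 1)) := summable_gaussTerm (by simp at h ⊢; linarith)
  have htel : ∀ m : ℕ, (c - a - b) * gaussTerm a b c m - (c - a) * (c - b) * gaussTerm a b (c + 1) m
      = m * gaussTerm a b c m - (m + 1 : ℕ) * gaussTerm a b c (m + 1) := by
    intro m
    have hf : (m.factorial : ℂ) ≠ 0 := by exact_mod_cast m.factorial_ne_zero
    have hm : (m : ℂ) + 1 ≠ 0 := by exact_mod_cast m.succ_ne_zero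
    simp only [gaussTerm, poch_succ, Nat.factorial_succ]
    rw [inv_Gamma_eq_mul_inv_Gamma_add_one (c + m), show c + 1 + m = c + m + 1 by ring]
    push_cast
    rw [show c + (m + 1) = c + m + 1 by ring]
    field_simp
    ring
  have hlim : Filter.Tendsto (fun m : ℕ => (m : ℂ) * gaussTerm a b c m) Filter.atTop (nhds 0) := by
    obtain ⟨C, hC0, hC⟩ := exists_norm_gaussTerm_le a b c
    have h1 : Filter.Tendsto (fun m : ℕ => C * ((m : ℝ) + 1) ^ (-(c - a - b).re))
        Filter.atTop (nhds (C * 0)) :=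
      ((tendsto_rpow_neg_atTop h).comp
        (Filter.tendsto_atTop_add_const_right _ 1 tendsto_natCast_atTop_atTop)).const_mul C
    rw [mul_zero] at h1
    refine squeeze_zero_norm (fun m => ?_) h1
    have hm : (0 : ℝ) < (m : ℝ) + 1 := by positivity
    rw [norm_mul, Complex.norm_natCast]
    have h2 : -(c - a - b).re = 1 + ((a + b - c).re - 1) := by simp; ring
    rw [h2, Real.rpow_add hm, Real.rpow_one]
    calc (m : ℝ) * ‖gaussTerm a b c m‖ ≤
        ((m : ℝ) + 1) * (C * ((m : ℝ) + 1) ^ ((a + b - c).re - 1)) :=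
          mul_le_mul (by linarith) (hC m) (norm_nonneg _) hm.le
      _ = _ := by ring
  have hsum := ((hs.hasSum.mul_left (c - a - b)).sub
    (hs'.hasSum.mul_left ((c - a) * (c - b)))).tendsto_sum_nat
  simp_rw [htel, Finset.sum_range_sub' (fun m : ℕ => (m : ℂ) * gaussTerm a b c m)] at hsum
  have h0 := tendsto_nhds_unique hsum (tendsto_const_nhds.sub hlim)
  simp only [Nat.cast_zero, zero_mul, sub_zero] at h0
  exact sub_eq_zero.1 h0

theorem tendsto_cpow_mul_factorial_div_Gamma {z : ℂ} (hz : 0 < z.re) :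
    Filter.Tendsto (fun n : ℕ => (n : ℂ) ^ z * (n.factorial : ℂ) / Complex.Gamma (z + (n + 1 : ℕ)))
      Filter.atTop (nhds 1) := by
  have hz' := ne_neg_nat_of_re_pos hz
  have h := (Complex.GammaSeq_tendsto_Gamma z).div_const (Complex.Gamma z)
  rw [div_self (Complex.Gamma_ne_zero hz')] at h
  refine h.congr fun n => ?_
  have hp : ∀ k : ℕ, ∏ j ∈ Finset.range k, (z + j) = poch z k := by
    intro k
    induction k with
    | zero => simp
    | succ k ih => rw [Finset.prod_range_succ, ih, poch_succ]
  rw [Complex.GammaSeq, hp, Gamma_add_nat_eq_poch hz', div_div]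

theorem norm_poch_le_norm_poch {r : ℝ} (hr : 0 < r) {d : ℂ} (hd : r ≤ d.re) (m : ℕ) :
    ‖poch r m‖ ≤ ‖poch d m‖ := by
  induction m with
  | zero => simp
  | succ m ih =>
    rw [poch_succ, poch_succ, norm_mul, norm_mul]
    gcongr
    have h1 : ((r : ℂ) + m) = ((r + m : ℝ) : ℂ) := by push_cast; rfl
    rw [h1, Complex.norm_real, Real.norm_of_nonneg (by positivity)]
    refine le_trans ?_ (Complex.re_le_norm _)
    simpa using hd

theorem tendsto_tsum_gaussTerm_mul_Gamma {a b c : ℂ} (hc : 0 < c.re) (h : 0 < (c - a - b).re) :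
    Filter.Tendsto (fun n : ℕ => (∑' m, gaussTerm a b (c + (n + 1 : ℕ)) m) *
      Complex.Gamma (c + (n + 1 : ℕ))) Filter.atTop (nhds 1) := by
  have hre : ∀ n : ℕ, c.re ≤ (c + (n + 1 : ℕ)).re := fun n => by
    simp
    positivity
  have hne : ∀ n k : ℕ, c + (n + 1 : ℕ) ≠ -(k : ℂ) := fun n =>
    ne_neg_nat_of_re_pos (hc.trans_le (hre n))
  have hcne : ∀ k : ℕ, (c.re : ℂ) ≠ -(k : ℂ) := ne_neg_nat_of_re_pos (by simpa using hc)
  set f : ℕ → ℕ → ℂ := fun n m => poch a m * poch b m / (m.factorial : ℂ) /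
    poch (c + (n + 1 : ℕ)) m with hf
  have hfG : ∀ n, (∑' m, gaussTerm a b (c + (n + 1 : ℕ)) m) * Complex.Gamma (c + (n + 1 : ℕ)) =
      ∑' m, f n m := by
    intro n
    rw [← tsum_mul_right]
    refine tsum_congr fun m => ?_
    have h1 := Complex.Gamma_ne_zero (hne n)
    have h2 := poch_ne_zero (hne n) m
    simp only [gaussTerm, hf]
    rw [Gamma_add_nat_eq_poch (hne n)]
    field_simp
  simp_rw [hfG]
  have hone : ∑' m : ℕ, (if m = 0 then (1 : ℂ) else 0) = 1 := tsum_ite_eq 0 _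
  rw [← hone]
  refine tendsto_tsum_of_dominated_convergence
    (bound := fun m => ‖poch a m * poch b m / (m.factorial : ℂ) / poch (c.re : ℂ) m‖) ?_ ?_ ?_
  · have hs : Summable (gaussTerm a b (c.re : ℂ)) := summable_gaussTerm (by simpa using h)
    refine (hs.mul_right (Complex.Gamma (c.re : ℂ))).norm.congr fun m => ?_
    have h1 := Complex.Gamma_ne_zero hcne
    have h2 := poch_ne_zero hcne m
    rw [gaussTerm, Gamma_add_nat_eq_poch hcne]
    congr 1
    field_simp
  · intro m
    rcases m with _ | k
    · simp [hf]
    · simp only [Nat.add_eq_zero_iff, one_ne_zero, and_false, if_false]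
      have hpos : 0 < ‖poch (c.re : ℂ) k‖ := norm_pos_iff.2 (poch_ne_zero hcne k)
      have hlim : Filter.Tendsto (fun n : ℕ =>
          ‖poch a (k + 1) * poch b (k + 1) / ((k + 1).factorial : ℂ)‖ / ‖poch (c.re : ℂ) k‖ *
            (1 / ((n : ℝ) + 1))) Filter.atTop (nhds (_ * 0)) :=
        tendsto_one_div_add_atTop_nhds_zero_nat.const_mul _
      rw [mul_zero] at hlim
      refine squeeze_zero_norm (fun n => ?_) hlim
      simp only [hf]
      rw [norm_div, poch_succ_left (c + _), norm_mul, div_mul_div_comm, mul_one, mul_comm ‖c + _‖]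
      gcongr
      · refine norm_poch_le_norm_poch hc ?_ k
        have := hre n
        simp at this ⊢
        linarith
      · refine le_trans ?_ (Complex.re_le_norm _)
        simp
        exact hc.le
  · refine Filter.Eventually.of_forall fun n m => ?_
    simp only [hf]
    rw [norm_div, norm_div _ (poch (c.re : ℂ) m)]
    have hpos : 0 < ‖poch (c.re : ℂ) m‖ := norm_pos_iff.2 (poch_ne_zero hcne m)
    gcongr
    exact norm_poch_le_norm_poch hc (hre n) m

/-- The right-hand side of Gauss's theorem satisfies the same contiguous relation as the series. -/
theorem gaussValue_contiguous {a b c : ℂ} (h : 0 < (c - a - b).re) :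
    (c - a - b) * (Complex.Gamma (c - a - b) *
        ((Complex.Gamma (c - a))⁻¹ * (Complex.Gamma (c - b))⁻¹)) =
      (c - a) * (c - b) * (Complex.Gamma (c + 1 - a - b) *
        ((Complex.Gamma (c + 1 - a))⁻¹ * (Complex.Gamma (c + 1 - b))⁻¹)) := by
  have h0 : c - a - b ≠ 0 := by
    intro h1
    simp [h1] at h
  rw [inv_Gamma_eq_mul_inv_Gamma_add_one (c - a), inv_Gamma_eq_mul_inv_Gamma_add_one (c - b),
    show c + 1 - a - b = c - a - b + 1 by ring, Complex.Gamma_add_one _ h0,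
    show c + 1 - a = c - a + 1 by ring, show c + 1 - b = c - b + 1 by ring]
  ring

/-- Gauss's theorem when all the arguments of `Γ` have positive real parts: by the contiguous
relation, the quotient of the two sides at `c` is the quotient at `c + n`, which tends to `1`. -/
theorem tsum_gaussTerm_of_re_pos {a b c : ℂ} (hc : 0 < c.re) (hca : 0 < (c - a).re)
    (hcb : 0 < (c - b).re) (h : 0 < (c - a - b).re) :
    ∑' m, gaussTerm a b c m = Complex.Gamma (c - a - b) *
      ((Complex.Gamma (c - a))⁻¹ * (Complex.Gamma (c - b))⁻¹) := by
  set G : ℂ → ℂ := fun c => ∑' m, gaussTerm a b c m with hG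
  set R : ℂ → ℂ := fun c => Complex.Gamma (c - a - b) *
      ((Complex.Gamma (c - a))⁻¹ * (Complex.Gamma (c - b))⁻¹) with hR
  have hshift : ∀ (z : ℂ) (n : ℕ), 0 < z.re → 0 < (z + n).re := fun z n hz => by
    simp; positivity
  have hne : ∀ {z : ℂ}, 0 < z.re → Complex.Gamma z ≠ 0 := fun hz =>
    Complex.Gamma_ne_zero (ne_neg_nat_of_re_pos hz)
  have hR0 : ∀ n : ℕ, R (c + n) ≠ 0 := fun n => by
    have h1 := hne (hshift _ n h)
    have h2 := hne (hshift _ n hca)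
    have h3 := hne (hshift _ n hcb)
    simp only [hR]
    rw [show c + n - a - b = c - a - b + n by ring, show c + n - a = c - a + n by ring,
      show c + n - b = c - b + n by ring]
    exact mul_ne_zero h1 (mul_ne_zero (inv_ne_zero h2) (inv_ne_zero h3))
  have hconst : ∀ n : ℕ, G (c + n) / R (c + n) = G c / R c := by
    intro n
    induction n with
    | zero => simp
    | succ n ih =>
      rw [← ih, div_eq_div_iff (hR0 _) (hR0 _)]
      have hpos : 0 < (c + n - a - b).re := by
        have := hshift _ n h
        rwa [show c - a - b + n = c + n - a - b by ring] at this
      have e1 : (c + n - a - b) * G (c + n) = (c + n - a) * (c + n - b) * G (c + n + 1) :=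
        tsum_gaussTerm_contiguous hpos
      have e2 : (c + n - a - b) * R (c + n) = (c + n - a) * (c + n - b) * R (c + n + 1) :=
        gaussValue_contiguous hpos
      have n1 : c + n - a ≠ 0 := fun h0 => by
        have := hshift _ n hca
        rw [show c - a + n = c + n - a by ring, h0] at this
        simp at this
      have n2 : c + n - b ≠ 0 := fun h0 => by
        have := hshift _ n hcb
        rw [show c - b + n = c + n - b by ring, h0] at this
        simp at this
      push_cast
      rw [← add_assoc]
      refine mul_left_cancel₀ (mul_ne_zero n1 n2) ?_
      linear_combination R (c + n) * (-e1) + G (c + n) * e2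
  have hlimG := tendsto_tsum_gaussTerm_mul_Gamma hc h
  have hlimR : Filter.Tendsto (fun n : ℕ => R (c + (n + 1 : ℕ)) * Complex.Gamma (c + (n + 1 : ℕ)))
      Filter.atTop (nhds 1) := by
    have t := ((tendsto_cpow_mul_factorial_div_Gamma hca).mul
      (tendsto_cpow_mul_factorial_div_Gamma hcb)).div
      ((tendsto_cpow_mul_factorial_div_Gamma hc).mul
        (tendsto_cpow_mul_factorial_div_Gamma h)) (by simp)
    simp only [mul_one, div_one] at t
    refine t.congr' ?_
    filter_upwards [Filter.eventually_gt_atTop 0] with n hn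
    have hn0 : (n : ℂ) ≠ 0 := by exact_mod_cast hn.ne'
    have g1 := hne (hshift _ (n + 1) h)
    have g2 := hne (hshift _ (n + 1) hca)
    have g3 := hne (hshift _ (n + 1) hcb)
    have g4 := hne (hshift _ (n + 1) hc)
    have hf : (n.factorial : ℂ) ≠ 0 := by exact_mod_cast n.factorial_ne_zero
    simp only [Pi.div_apply, hR]
    have hpow : (n : ℂ) ^ (c - a) * (n : ℂ) ^ (c - b) = (n : ℂ) ^ c * (n : ℂ) ^ (c - a - b) := by
      rw [← Complex.cpow_add _ _ hn0, ← Complex.cpow_add _ _ hn0]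
      congr 1
      ring
    have p1 : (n : ℂ) ^ c ≠ 0 := by simp [Complex.cpow_eq_zero_iff, hn0]
    have p2 : (n : ℂ) ^ (c - a - b) ≠ 0 := by simp [Complex.cpow_eq_zero_iff, hn0]
    rw [show c + (n + 1 : ℕ) - a - b = c - a - b + (n + 1 : ℕ) by ring,
      show c + (n + 1 : ℕ) - a = c - a + (n + 1 : ℕ) by ring,
      show c + (n + 1 : ℕ) - b = c - b + (n + 1 : ℕ) by ring]
    generalize Complex.Gamma (c - a - b + (n + 1 : ℕ)) = x1 at *
    generalize Complex.Gamma (c - a + (n + 1 : ℕ)) = x2 at *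
    generalize Complex.Gamma (c - b + (n + 1 : ℕ)) = x3 at *
    generalize Complex.Gamma (c + (n + 1 : ℕ)) = x4 at *
    generalize (n : ℂ) ^ c = y1 at *
    generalize (n : ℂ) ^ (c - a - b) = y2 at *
    generalize (n : ℂ) ^ (c - a) = y3 at *
    generalize (n : ℂ) ^ (c - b) = y4 at *
    field_simp
    linear_combination hpow
  have hlim := hlimG.div hlimR one_ne_zero
  rw [div_one] at hlim
  have hq : G c / R c = 1 := by
    refine tendsto_nhds_unique (tendsto_const_nhds.congr fun n => ?_) hlim
    have g4 := hne (hshift _ (n + 1) hc)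
    rw [← hconst (n + 1)]
    simp only [Pi.div_apply]
    rw [mul_div_mul_right _ _ g4]
  have hRc : R c ≠ 0 := by simpa using hR0 0
  exact (div_eq_one_iff_eq hRc).1 hq

/-- **Gauss's theorem**, in the regularized form that allows every `c`. -/
theorem hasSum_gaussTerm {a b c : ℂ} (h : 0 < (c - a - b).re) :
    HasSum (gaussTerm a b c) (Complex.Gamma (c - a - b) *
      ((Complex.Gamma (c - a))⁻¹ * (Complex.Gamma (c - b))⁻¹)) := by
  refine (summable_gaussTerm h).hasSum_iff.2 ?_
  obtain ⟨k, hk⟩ := exists_nat_gt (max (-c.re) (max (-(c - a).re) (-(c - b).re)))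
  induction k generalizing c with
  | zero =>
    simp only [Nat.cast_zero, max_lt_iff, neg_lt_zero] at hk
    exact tsum_gaussTerm_of_re_pos hk.1 hk.2.1 hk.2.2 h
  | succ k ih =>
    have h1 := ih (c := c + 1) (by simp at h ⊢; linarith) (by
      simp only [max_lt_iff, Complex.sub_re, Complex.add_re, Complex.one_re] at hk ⊢
      push_cast at hk
      refine ⟨?_, ?_, ?_⟩ <;> linarith)
    have h0 : c - a - b ≠ 0 := by
      intro h1
      simp [h1] at h
    refine mul_left_cancel₀ h0 ?_
    rw [tsum_gaussTerm_contiguous h, h1, gaussValue_contiguous h]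

/-! ### Power series in two variables with polynomially bounded coefficients -/

theorem summable_mul_pow_mul_pow {f : ℕ × ℕ → ℂ} {C e₁ e₂ e₃ : ℝ} (hC : 0 ≤ C)
    (hf : ∀ m n : ℕ, ‖f (m, n)‖ ≤
      C * (((m : ℝ) + 1) ^ e₁ * ((n : ℝ) + 1) ^ e₂ * ((m : ℝ) + n + 1) ^ e₃))
    {r s : ℝ} (hr0 : 0 ≤ r) (hr : r < 1) (hs0 : 0 ≤ s) (hs : s < 1) :
    Summable fun i : ℕ × ℕ => ‖f i‖ * r ^ i.1 * s ^ i.2 := by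
  have h := ((summable_rpow_mul_geometric (e₁ + |e₃|) hr0 hr).mul_of_nonneg
    (summable_rpow_mul_geometric (e₂ + |e₃|) hs0 hs) (fun n => by positivity)
    (fun n => by positivity)).mul_left C
  refine h.of_nonneg_of_le (fun i => by positivity) fun ⟨m, n⟩ => ?_
  have h1 := hf m n
  have h2 := add_add_one_rpow_le m n e₃
  simp only
  rw [Real.rpow_add (by positivity), Real.rpow_add (by positivity)]
  calc ‖f (m, n)‖ * r ^ m * s ^ n ≤
      (C * (((m : ℝ) + 1) ^ e₁ * ((n : ℝ) + 1) ^ e₂ *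
        (((m : ℝ) + 1) ^ |e₃| * ((n : ℝ) + 1) ^ |e₃|))) * r ^ m * s ^ n := by
        gcongr
        exact h1.trans (by gcongr)
    _ = _ := by ring

theorem norm_mul_pow_mul_pow (c u z : ℂ) (m n : ℕ) :
    ‖c * u ^ m * z ^ n‖ = ‖c‖ * ‖u‖ ^ m * ‖z‖ ^ n := by
  rw [norm_mul, norm_mul, norm_pow, norm_pow]

theorem differentiableOn_tsum_mul_pow_mul_pow {f : ℕ × ℕ → ℂ} {u : ℂ} (hu : ‖u‖ < 1)
    (hf : ∀ r s : ℝ, 0 ≤ r → r < 1 → 0 ≤ s → s < 1 →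
      Summable fun i : ℕ × ℕ => ‖f i‖ * r ^ i.1 * s ^ i.2) :
    DifferentiableOn ℂ (fun z => ∑' i : ℕ × ℕ, f i * u ^ i.1 * z ^ i.2) {z | ‖z‖ < 1} := by
  intro z hz
  obtain ⟨s, hzs, hs⟩ := exists_between (show ‖z‖ < 1 from hz)
  have hs0 : 0 ≤ s := (norm_nonneg z).trans hzs.le
  have hopen : IsOpen {w : ℂ | ‖w‖ < s} := isOpen_lt continuous_norm continuous_const
  have h : DifferentiableOn ℂ (fun z => ∑' i : ℕ × ℕ, f i * u ^ i.1 * z ^ i.2) {w | ‖w‖ < s} := by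
    refine Complex.differentiableOn_tsum_of_summable_norm (hf ‖u‖ s (norm_nonneg u) hu hs0 hs)
      (fun i => by fun_prop) hopen fun i w hw => ?_
    rw [norm_mul_pow_mul_pow]
    have hw' : ‖w‖ ≤ s := le_of_lt hw
    gcongr
  exact (h.differentiableAt (hopen.mem_nhds hzs)).differentiableWithinAt

/-! ### Pfaff's transformation -/

theorem sum_antidiagonal_choose_mul_poch_div_poch (N : ℕ) (c d : ℂ)
    (hc : ∀ n : ℕ, c ≠ -(n : ℂ)) :
    ∑ ij ∈ Finset.HasAntidiagonal.antidiagonal N, (N.choose ij.1 : ℂ) * ((-1) ^ ij.1 * (poch d ij.1 / poch c ij.1))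
      = poch (c - d) N / poch c N := by
  induction N generalizing c d with
  | zero => simp
  | succ N ih =>
    have hc1 : ∀ n : ℕ, c + 1 ≠ -(n : ℂ) := fun n => by
      simpa using add_nat_ne_neg_nat hc 1 n
    have hc0 : c ≠ 0 := by simpa using hc 0
    have h2 : ∀ ij ∈ Finset.HasAntidiagonal.antidiagonal N,
        (N.choose ij.2 : ℂ) * ((-1) ^ (ij.1 + 1) * (poch d (ij.1 + 1) / poch c (ij.1 + 1))) =
        -(d / c) * ((N.choose ij.1 : ℂ) *
          ((-1) ^ ij.1 * (poch (d + 1) ij.1 / poch (c + 1) ij.1))) := by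
      intro ij hij
      rw [Nat.choose_symm_of_eq_add (Finset.HasAntidiagonal.mem_antidiagonal.1 hij).symm, poch_succ_left,
        poch_succ_left]
      have := poch_ne_zero hc1 ij.1
      field_simp
      ring
    rw [Finset.sum_antidiagonal_choose_succ_mul
      (fun i _ => (-1 : ℂ) ^ i * (poch d i / poch c i)) N, Finset.sum_congr rfl h2,
      ← Finset.mul_sum, ih c d hc, ih (c + 1) (d + 1) hc1]
    have e1 := poch_ne_zero hc N
    have e2 := poch_ne_zero hc1 N
    have e3 : c + N ≠ 0 := fun h => hc N (eq_neg_of_add_eq_zero_left h)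
    have e4 : poch c N * (c + N) = c * poch (c + 1) N := by rw [← poch_succ, poch_succ_left]
    rw [show c + 1 - (d + 1) = c - d by ring, poch_succ, poch_succ]
    have e5 : poch (c - d) N / poch (c + 1) N = poch (c - d) N * c / (poch c N * (c + N)) := by
      rw [e4]; field_simp
    rw [neg_mul, div_mul_eq_mul_div, mul_div_assoc, e5]
    field_simp
    ring

theorem choose_eq_poch_div_factorial (a : ℂ) (k : ℕ) :
    Ring.choose (a + k - 1) k = poch a k / (k.factorial : ℂ) := by
  have hf : (k.factorial : ℂ) ≠ 0 := by exact_mod_cast k.factorial_ne_zero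
  have h := Ring.factorial_nsmul_multichoose_eq_ascPochhammer a k
  rw [eq_div_iff hf, Ring.choose, show a + k - 1 - k + 1 = a by ring, mul_comm, ← nsmul_eq_mul, h,
    poch, Polynomial.ascPochhammer_smeval_eq_eval]

theorem hasSum_binomial (a : ℂ) {v : ℂ} (hv : ‖v‖ < 1) :
    HasSum (fun k : ℕ => poch a k / (k.factorial : ℂ) * v ^ k) ((1 - v) ^ (-a)) := by
  have hv' : v ∈ Metric.eball (0 : ℂ) 1 := by
    rw [mem_eball_zero_iff, ← ofReal_norm]
    exact ENNReal.ofReal_lt_one.2 hv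
  have h := (Complex.one_div_one_sub_cpow_hasFPowerSeriesOnBall_zero a).hasSum hv'
  simp only [zero_add, FormalMultilinearSeries.ofScalars_apply_eq, choose_eq_poch_div_factorial,
    smul_eq_mul] at h
  rwa [Complex.cpow_neg, ← one_div]

theorem norm_div_sub_one_lt_one {v : ℂ} (hv : v.re < 1 / 2) : ‖v / (v - 1)‖ < 1 := by
  have h1 : ‖v‖ ^ 2 < ‖v - 1‖ ^ 2 := by
    rw [Complex.sq_norm, Complex.sq_norm, Complex.normSq_apply, Complex.normSq_apply]
    simp
    nlinarith
  have h2 := lt_of_pow_lt_pow_left₀ 2 (norm_nonneg _) h1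
  rw [norm_div, div_lt_one ((norm_nonneg _).trans_lt h2)]
  exact h2

/-- **Pfaff's transformation** of `₂F₁` near the origin. Expanding the powers of `1 - v` on the
right-hand side gives a double series, summed along the antidiagonals by the finite
Chu–Vandermonde identity. -/
theorem tsum_pfaff (a b c : ℂ) (hc : ∀ n : ℕ, c ≠ -(n : ℂ)) {v : ℂ} (hv : ‖v‖ < 1 / 2) :
    ∑' n : ℕ, poch a n * poch b n / (poch c n * (n.factorial : ℂ)) * v ^ n =
      (1 - v) ^ (-a) * ∑' n : ℕ, poch a n * poch (c - b) n / (poch c n * (n.factorial : ℂ)) *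
        (v / (v - 1)) ^ n := by
  have hv1 : ‖v‖ < 1 := by linarith
  have hfac : ∀ n : ℕ, (n.factorial : ℂ) ≠ 0 := fun n => by exact_mod_cast n.factorial_ne_zero
  have h1v : 1 - v ≠ 0 := by
    intro h
    rw [← sub_eq_zero.1 h, norm_one] at hv1
    exact lt_irrefl _ hv1
  set g : ℕ × ℕ → ℂ := fun i => poch a (i.1 + i.2) * poch (c - b) i.1 * (-1) ^ i.1 /
    (poch c i.1 * (i.1.factorial : ℂ) * (i.2.factorial : ℂ)) with hg
  have hsum : Summable fun i : ℕ × ℕ => g i * v ^ i.1 * v ^ i.2 := by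
    obtain ⟨A, hA, ha⟩ := exists_norm_poch_div_factorial_le a
    obtain ⟨B, hB, hb⟩ := exists_norm_poch_div_poch_zero_le (c - b) c hc
    -- The binomial coefficient `(m + n).choose m ≤ 2 ^ (m + n)` is what restricts `v` to `|v| < 1/2`.
    have hbd : ∀ m n : ℕ, ‖g (m, n) / 2 ^ (m + n)‖ ≤ A * B *
        (((m : ℝ) + 1) ^ (c - b - c).re * ((n : ℝ) + 1) ^ (0 : ℝ) *
          ((m : ℝ) + n + 1) ^ (a.re - 1)) := by
      intro m n
      have e1 : g (m, n) / 2 ^ (m + n) = poch a (m + n) / ((m + n).factorial : ℂ) *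
          (poch (c - b) m / poch c m) *
          ((-1) ^ m * (((m + n).choose m : ℂ) / 2 ^ (m + n))) := by
        have e2 : ((m + n).choose m : ℂ) * (m.factorial : ℂ) * (n.factorial : ℂ) =
            ((m + n).factorial : ℂ) := by
          rw [Nat.choose_symm_add]
          exact_mod_cast Nat.add_choose_mul_factorial_mul_factorial m n
        have e3 : ((m + n).choose m : ℂ) ≠ 0 := by
          exact_mod_cast (Nat.choose_pos (Nat.le_add_right m n)).ne'
        have e4 := hfac m
        have e5 := hfac n
        have e6 := poch_ne_zero hc m
        simp only [hg]
        rw [← e2]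
        field_simp
      have e2 : ‖(-1 : ℂ) ^ m * (((m + n).choose m : ℂ) / 2 ^ (m + n))‖ ≤ 1 := by
        rw [norm_mul, norm_pow, norm_neg, norm_one, one_pow, one_mul, norm_div, norm_pow,
          Complex.norm_natCast, Complex.norm_ofNat, div_le_one (by positivity)]
        exact_mod_cast Nat.choose_le_two_pow _ _
      rw [e1, norm_mul, norm_mul]
      have a1 := ha (m + n)
      push_cast at a1
      calc _ ≤ A * ((m : ℝ) + n + 1) ^ (a.re - 1) * (B * ((m : ℝ) + 1) ^ (c - b - c).re) * 1 := by
            gcongr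
            exact hb m
        _ = _ := by rw [Real.rpow_zero]; ring
    have h := summable_mul_pow_mul_pow (f := fun i => g i / 2 ^ (i.1 + i.2)) (mul_pos hA hB).le hbd
      (r := 2 * ‖v‖) (s := 2 * ‖v‖)
      (by positivity) (by linarith) (by positivity) (by linarith)
    refine Summable.of_norm (h.congr fun i => ?_)
    rw [norm_mul_pow_mul_pow, norm_div, norm_pow, Complex.norm_ofNat, mul_pow, mul_pow, pow_add]
    field_simp
  have hrow : ∑' i : ℕ × ℕ, g i * v ^ i.1 * v ^ i.2 =
      (1 - v) ^ (-a) * ∑' n : ℕ, poch a n * poch (c - b) n / (poch c n * (n.factorial : ℂ)) *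
        (v / (v - 1)) ^ n := by
    rw [hsum.tsum_prod, ← tsum_mul_left]
    refine tsum_congr fun n => ?_
    have e1 : ∀ k : ℕ, g (n, k) * v ^ n * v ^ k = poch a n * poch (c - b) n /
        (poch c n * (n.factorial : ℂ)) * (-v) ^ n *
          (poch (a + n) k / (k.factorial : ℂ) * v ^ k) := by
      intro k
      have e4 := hfac n
      have e5 := hfac k
      have e6 := poch_ne_zero hc n
      simp only [hg]
      rw [poch_add, neg_pow v]
      field_simp
    simp_rw [e1]
    rw [tsum_mul_left, (hasSum_binomial (a + n) hv1).tsum_eq, neg_add, Complex.cpow_add _ _ h1v,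
      Complex.cpow_neg _ (n : ℂ), Complex.cpow_natCast, show v / (v - 1) = -v / (1 - v) by
        rw [← neg_sub, div_neg, neg_div], div_pow]
    ring
  have hsigma := Finset.HasAntidiagonal.sigmaAntidiagonalEquivProd.summable_iff.2 hsum
  rw [← hrow]
  refine Eq.trans ?_ ((hsigma.tsum_sigma' fun n => (hasSum_fintype _).summable).symm.trans
    (Finset.HasAntidiagonal.sigmaAntidiagonalEquivProd.tsum_eq
      fun i : ℕ × ℕ => g i * v ^ i.1 * v ^ i.2))
  refine tsum_congr fun N => ?_
  rw [tsum_fintype (L := .unconditional _)]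
  simp only [Function.comp_apply, Finset.HasAntidiagonal.sigmaAntidiagonalEquivProd_apply]
  rw [Finset.sum_coe_sort (Finset.HasAntidiagonal.antidiagonal N)
    (fun i : ℕ × ℕ => g i * v ^ i.1 * v ^ i.2)]
  have e1 : ∀ i ∈ Finset.HasAntidiagonal.antidiagonal N, g i * v ^ i.1 * v ^ i.2 =
      poch a N / (N.factorial : ℂ) * v ^ N * ((N.choose i.1 : ℂ) *
        ((-1) ^ i.1 * (poch (c - b) i.1 / poch c i.1))) := by
    rintro ⟨m, n⟩ hi
    rw [Finset.HasAntidiagonal.mem_antidiagonal] at hi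
    simp only at hi
    subst hi
    have e2 : ((m + n).choose m : ℂ) * (m.factorial : ℂ) * (n.factorial : ℂ) =
        ((m + n).factorial : ℂ) := by
      rw [Nat.choose_symm_add]
      exact_mod_cast Nat.add_choose_mul_factorial_mul_factorial m n
    have e3 : ((m + n).choose m : ℂ) ≠ 0 := by
      exact_mod_cast (Nat.choose_pos (Nat.le_add_right m n)).ne'
    have e4 := hfac m
    have e5 := hfac n
    have e6 := poch_ne_zero hc m
    simp only [hg]
    rw [← e2, pow_add]
    field_simp
  rw [Finset.sum_congr rfl e1, ← Finset.mul_sum,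
    sum_antidiagonal_choose_mul_poch_div_poch N c (c - b) hc, sub_sub_cancel]
  have e4 := hfac N
  have e6 := poch_ne_zero hc N
  field_simp

/-! ### Analytic continuation of Appell's function -/

/-- The coefficients of the double power series
`∑ (α)ₘ (β)ₘ (α')ₙ (γ + m - β')ₙ / ((γ)ₘ₊ₙ m! n!) uᵐ zⁿ`, which arises from `F₃` when Pfaff's
transformation is applied to the sums over `n`. -/
noncomputable def kernelCoeff (α α' β β' γ : ℂ) (i : ℕ × ℕ) : ℂ :=
  poch α i.1 * poch β i.1 * (poch α' i.2 * poch (γ + i.1 - β') i.2) /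
    (poch γ (i.1 + i.2) * (i.1.factorial : ℂ) * (i.2.factorial : ℂ))

theorem exists_norm_kernelCoeff_le (α α' β β' : ℂ) {γ : ℂ} (hγ : ∀ n : ℕ, γ ≠ -(n : ℂ)) :
    ∃ C : ℝ, 0 < C ∧ ∀ m n : ℕ, ‖kernelCoeff α α' β β' γ (m, n)‖ ≤
      C * (((m : ℝ) + 1) ^ ((α + β + β' - γ).re - 1) * ((n : ℝ) + 1) ^ (α'.re - 1) *
        ((m : ℝ) + n + 1) ^ (-β'.re)) := by
  obtain ⟨A, hA, ha⟩ := exists_norm_poch_div_factorial_le α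
  obtain ⟨A', hA', ha'⟩ := exists_norm_poch_div_factorial_le α'
  obtain ⟨B, hB, hb⟩ := exists_norm_poch_div_poch_zero_le β γ hγ
  obtain ⟨B', hB', hb'⟩ := exists_norm_poch_div_poch_le (γ - β') γ hγ
  refine ⟨A * A' * B * B', by positivity, fun m n => ?_⟩
  have e1 : kernelCoeff α α' β β' γ (m, n) = poch α m / (m.factorial : ℂ) *
      (poch α' n / (n.factorial : ℂ)) * (poch β m / poch γ m) *
      (poch (γ - β' + m) n / poch (γ + m) n) := by
    simp only [kernelCoeff]
    rw [poch_add, show γ + m - β' = γ - β' + m by ring]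
    ring
  have hm : (0 : ℝ) < (m : ℝ) + 1 := by positivity
  rw [e1, norm_mul, norm_mul, norm_mul]
  calc _ ≤ A * ((m : ℝ) + 1) ^ (α.re - 1) * (A' * ((n : ℝ) + 1) ^ (α'.re - 1)) *
        (B * ((m : ℝ) + 1) ^ (β - γ).re) *
        (B' * (((m : ℝ) + n + 1) ^ (γ - β' - γ).re * ((m : ℝ) + 1) ^ (-(γ - β' - γ).re))) := by
        gcongr
        · exact ha m
        · exact ha' n
        · exact hb m
        · exact hb' m n
    _ = _ := by
        rw [show (α + β + β' - γ).re - 1 = (α.re - 1) + (β - γ).re + (-(γ - β' - γ).re) by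
            simp; ring, Real.rpow_add hm, Real.rpow_add hm,
          show (γ - β' - γ).re = -β'.re by simp]
        ring

theorem summable_kernelCoeff (α α' β β' : ℂ) {γ : ℂ} (hγ : ∀ n : ℕ, γ ≠ -(n : ℂ)) (r s : ℝ)
    (hr0 : 0 ≤ r) (hr : r < 1) (hs0 : 0 ≤ s) (hs : s < 1) :
    Summable fun i : ℕ × ℕ => ‖kernelCoeff α α' β β' γ i‖ * r ^ i.1 * s ^ i.2 := by
  obtain ⟨C, hC, h⟩ := exists_norm_kernelCoeff_le α α' β β' hγ
  exact summable_mul_pow_mul_pow hC.le h hr0 hr hs0 hs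

/-- The double power series with coefficients `kernelCoeff`. -/
noncomputable def kernelSeries (α α' β β' γ u z : ℂ) : ℂ :=
  ∑' i : ℕ × ℕ, kernelCoeff α α' β β' γ i * u ^ i.1 * z ^ i.2

theorem summable_kernelSeries (α α' β β' : ℂ) {γ u z : ℂ} (hγ : ∀ n : ℕ, γ ≠ -(n : ℂ))
    (hu : ‖u‖ < 1) (hz : ‖z‖ < 1) :
    Summable fun i : ℕ × ℕ => kernelCoeff α α' β β' γ i * u ^ i.1 * z ^ i.2 :=
  Summable.of_norm ((summable_kernelCoeff α α' β β' hγ ‖u‖ ‖z‖ (norm_nonneg u) hu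
    (norm_nonneg z) hz).congr fun _ => (norm_mul_pow_mul_pow _ _ _ _ _).symm)

/-- The coefficients of the double power series of `F₃`. -/
noncomputable def appellF3Coeff (α α' β β' γ : ℂ) (i : ℕ × ℕ) : ℂ :=
  poch α i.1 * poch α' i.2 * poch β i.1 * poch β' i.2 /
    (poch γ (i.1 + i.2) * (i.1.factorial : ℂ) * (i.2.factorial : ℂ))

theorem summable_appellF3Coeff (α α' β β' : ℂ) {γ : ℂ} (hγ : ∀ n : ℕ, γ ≠ -(n : ℂ)) (r s : ℝ)
    (hr0 : 0 ≤ r) (hr : r < 1) (hs0 : 0 ≤ s) (hs : s < 1) :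
    Summable fun i : ℕ × ℕ => ‖appellF3Coeff α α' β β' γ i‖ * r ^ i.1 * s ^ i.2 := by
  obtain ⟨A, hA, ha⟩ := exists_norm_poch_div_factorial_le α
  obtain ⟨A', hA', ha'⟩ := exists_norm_poch_div_factorial_le α'
  obtain ⟨B, hB, hb⟩ := exists_norm_poch_div_factorial_le β
  obtain ⟨B', hB', hb'⟩ := exists_norm_poch_div_factorial_le β'
  obtain ⟨D, hD, hd⟩ := exists_norm_poch_div_poch_zero_le 1 γ hγ
  have hbd : ∀ m n : ℕ, ‖appellF3Coeff α α' β β' γ (m, n)‖ ≤ A * A' * B * B' * D *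
      (((m : ℝ) + 1) ^ (α.re - 1 + (β.re - 1)) * ((n : ℝ) + 1) ^ (α'.re - 1 + (β'.re - 1)) *
        ((m : ℝ) + n + 1) ^ (1 - γ).re) := by
    intro m n
    have hm : (m.factorial : ℂ) ≠ 0 := by exact_mod_cast m.factorial_ne_zero
    have hn : (n.factorial : ℂ) ≠ 0 := by exact_mod_cast n.factorial_ne_zero
    have hmn : ((m + n).factorial : ℂ) ≠ 0 := by exact_mod_cast (m + n).factorial_ne_zero
    have e1 : appellF3Coeff α α' β β' γ (m, n) = poch α m / (m.factorial : ℂ) *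
        (poch α' n / (n.factorial : ℂ)) * (poch β m / (m.factorial : ℂ)) *
        (poch β' n / (n.factorial : ℂ)) * (poch 1 (m + n) / poch γ (m + n)) *
        ((m.factorial : ℂ) * (n.factorial : ℂ) / ((m + n).factorial : ℂ)) := by
      simp only [appellF3Coeff]
      rw [poch_one]
      have := poch_ne_zero hγ (m + n)
      field_simp
    have e2 : ‖(m.factorial : ℂ) * (n.factorial : ℂ) / ((m + n).factorial : ℂ)‖ ≤ 1 := by
      rw [norm_div, norm_mul, Complex.norm_natCast, Complex.norm_natCast, Complex.norm_natCast,
        div_le_one (by positivity)]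
      exact_mod_cast Nat.le_of_dvd (Nat.factorial_pos _) (Nat.factorial_mul_factorial_dvd_factorial_add m n)
    have d1 := hd (m + n)
    push_cast at d1
    have hm0 : (0 : ℝ) < (m : ℝ) + 1 := by positivity
    have hn0 : (0 : ℝ) < (n : ℝ) + 1 := by positivity
    rw [e1, norm_mul, norm_mul, norm_mul, norm_mul, norm_mul, Real.rpow_add hm0, Real.rpow_add hn0]
    calc _ ≤ A * ((m : ℝ) + 1) ^ (α.re - 1) * (A' * ((n : ℝ) + 1) ^ (α'.re - 1)) *
          (B * ((m : ℝ) + 1) ^ (β.re - 1)) * (B' * ((n : ℝ) + 1) ^ (β'.re - 1)) *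
          (D * ((m : ℝ) + n + 1) ^ (1 - γ).re) * 1 := by
          gcongr
          · exact ha m
          · exact ha' n
          · exact hb m
          · exact hb' n
      _ = _ := by ring
  exact summable_mul_pow_mul_pow (by positivity) hbd hr0 hr hs0 hs

theorem summable_appellF3Term (α α' β β' : ℂ) {γ u v : ℂ} (hγ : ∀ n : ℕ, γ ≠ -(n : ℂ))
    (hu : ‖u‖ < 1) (hv : ‖v‖ < 1) : Summable (appellF3Term α α' β β' γ u v) :=
  Summable.of_norm ((summable_appellF3Coeff α α' β β' hγ ‖u‖ ‖v‖ (norm_nonneg u) hu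
    (norm_nonneg v) hv).congr fun _ => (norm_mul_pow_mul_pow _ _ _ _ _).symm)

theorem tsum_appellF3Term_eq_of_norm_lt (α α' β β' : ℂ) {γ u v : ℂ} (hγ : ∀ n : ℕ, γ ≠ -(n : ℂ))
    (hu : ‖u‖ < 1) (hv : ‖v‖ < 1 / 2) :
    ∑' i, appellF3Term α α' β β' γ u v i =
      (1 - v) ^ (-α') * kernelSeries α α' β β' γ u (v / (v - 1)) := by
  have hre : v.re < 1 / 2 := (Complex.re_le_norm v).trans_lt hv
  rw [(summable_appellF3Term α α' β β' hγ hu (by linarith)).tsum_prod, kernelSeries,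
    (summable_kernelSeries α α' β β' hγ hu (norm_div_sub_one_lt_one hre)).tsum_prod,
    ← tsum_mul_left]
  refine tsum_congr fun m => ?_
  have hγm := add_nat_ne_neg_nat hγ m
  have e1 : ∀ n, appellF3Term α α' β β' γ u v (m, n) =
      poch α m * poch β m / (poch γ m * (m.factorial : ℂ)) * u ^ m *
        (poch α' n * poch β' n / (poch (γ + m) n * (n.factorial : ℂ)) * v ^ n) := by
    intro n
    simp only [appellF3Term]
    rw [poch_add]
    ring
  have e2 : ∀ n, kernelCoeff α α' β β' γ (m, n) * u ^ m * (v / (v - 1)) ^ n =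
      poch α m * poch β m / (poch γ m * (m.factorial : ℂ)) * u ^ m *
        (poch α' n * poch (γ + m - β') n / (poch (γ + m) n * (n.factorial : ℂ)) *
          (v / (v - 1)) ^ n) := by
    intro n
    simp only [kernelCoeff]
    rw [poch_add]
    ring
  simp_rw [e1, e2]
  rw [tsum_mul_left, tsum_mul_left, tsum_pfaff α' β' (γ + m) hγm hv]
  ring

theorem differentiableOn_kernelSeries_div_sub_one (α α' β β' : ℂ) {γ u : ℂ}
    (hγ : ∀ n : ℕ, γ ≠ -(n : ℂ)) (hu : ‖u‖ < 1) :
    DifferentiableOn ℂ (fun v => (1 - v) ^ (-α') * kernelSeries α α' β β' γ u (v / (v - 1)))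
      {v | v.re < 1 / 2} := by
  have h1 : ∀ v ∈ {v : ℂ | v.re < 1 / 2}, v - 1 ≠ 0 := by
    intro v hv h
    rw [sub_eq_zero] at h
    norm_num [h] at hv
  refine DifferentiableOn.mul ?_ ?_
  · refine DifferentiableOn.cpow_const (by fun_prop) fun v hv => Or.inl ?_
    simp only [Set.mem_ofPred_eq] at hv
    simp
    linarith
  · exact (differentiableOn_tsum_mul_pow_mul_pow hu (summable_kernelCoeff α α' β β' hγ)).comp
      (t := {z | ‖z‖ < 1}) (f := fun v => v / (v - 1))
      (DifferentiableOn.div (by fun_prop) (by fun_prop) h1)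
      fun v hv => norm_div_sub_one_lt_one hv

/-- The continuation of `F₃` to the half-plane `Re v < 1/2` through Pfaff's transformation. The two
analytic expressions agree near `0`, hence on the lens where both are defined. -/
theorem appellF3_eq_kernelSeries (α α' β β' : ℂ) {γ u v : ℂ} (hγ : ∀ n : ℕ, γ ≠ -(n : ℂ))
    (hu : ‖u‖ < 1) (hv : v.re < 1 / 2) :
    appellF3 α α' β β' γ u v =
      (1 - v) ^ (-α') * kernelSeries α α' β β' γ u (v / (v - 1)) := by
  classical
  set A : ℂ → ℂ := fun v => ∑' i, appellF3Term α α' β β' γ u v i with hA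
  set B : ℂ → ℂ := fun v => (1 - v) ^ (-α') * kernelSeries α α' β β' γ u (v / (v - 1)) with hB
  have hAd : DifferentiableOn ℂ A {v | ‖v‖ < 1} :=
    differentiableOn_tsum_mul_pow_mul_pow hu (summable_appellF3Coeff α α' β β' hγ)
  have hBd : DifferentiableOn ℂ B {v | v.re < 1 / 2} :=
    differentiableOn_kernelSeries_div_sub_one α α' β β' hγ hu
  have ho1 : IsOpen {v : ℂ | ‖v‖ < 1} := isOpen_lt continuous_norm continuous_const
  have ho2 : IsOpen {v : ℂ | v.re < 1 / 2} := isOpen_lt Complex.continuous_re continuous_const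
  have hAB : Set.EqOn A B ({v | ‖v‖ < 1} ∩ {v | v.re < 1 / 2}) := by
    have hconv : Convex ℝ ({v : ℂ | ‖v‖ < 1} ∩ {v | v.re < 1 / 2}) := by
      have h1 : {v : ℂ | ‖v‖ < 1} = Metric.ball 0 1 := by ext; simp
      rw [h1]
      exact (convex_ball _ _).inter (convex_halfSpace_re_lt _)
    refine ((hAd.mono Set.inter_subset_left).analyticOnNhd (ho1.inter ho2)).eqOn_of_preconnected_of_eventuallyEq
      ((hBd.mono Set.inter_subset_right).analyticOnNhd (ho1.inter ho2)) hconv.isPreconnected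
      (z₀ := 0) (by simp) ?_
    filter_upwards [Metric.ball_mem_nhds (0 : ℂ) (show (0 : ℝ) < 1 / 2 by norm_num)] with w hw
    exact tsum_appellF3Term_eq_of_norm_lt α α' β β' hγ hu (by simpa using hw)
  have hF : IsAppellF3Continuation α α' β β' γ u (fun v => if ‖v‖ < 1 then A v else B v) := by
    have eA : Set.EqOn (fun v => if ‖v‖ < 1 then A v else B v) A {v | ‖v‖ < 1} := fun w hw =>
      if_pos hw
    have eB : Set.EqOn (fun v => if ‖v‖ < 1 then A v else B v) B {v | v.re < 1 / 2} := by
      intro w hw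
      by_cases h1 : ‖w‖ < 1
      · simpa [h1] using hAB ⟨h1, hw⟩
      · simp [h1]
    refine ⟨?_, fun w hw => ?_⟩
    · rintro w (hw | hw)
      · exact (((hAd.congr eA).differentiableAt (ho1.mem_nhds hw))).differentiableWithinAt
      · exact (((hBd.congr eB).differentiableAt (ho2.mem_nhds hw))).differentiableWithinAt
    · simp only [hw, if_true]
      exact (summable_appellF3Term α α' β β' hγ hu hw).hasSum
  rw [hF.appellF3_eq (Or.inr hv)]
  change (if ‖v‖ < 1 then A v else B v) = B v
  by_cases h1 : ‖v‖ < 1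
  · simpa [h1] using hAB ⟨h1, hv⟩
  · simp [h1]

/-! ### The Mellin transform of the kernel -/

open MeasureTheory Set

/-- Termwise integration of a series of functions whose `L¹`-norms are summable; the sum is then
integrable. -/
theorem integrable_and_hasSum_integral_of_summable {X ι : Type*} [MeasurableSpace X]
    {μ : Measure X} [Countable ι] {F : ι → X → ℂ} {f : X → ℂ} (hF : ∀ i, Integrable (F i) μ)
    (hsum : Summable fun i => ∫ a, ‖F i a‖ ∂μ) (hf : ∀ᵐ a ∂μ, HasSum (fun i => F i a) (f a)) :
    Integrable f μ ∧ HasSum (fun i => ∫ a, F i a ∂μ) (∫ a, f a ∂μ) := by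
  constructor
  · refine ⟨?_, ?_⟩
    · refine aestronglyMeasurable_of_tendsto_ae (u := Filter.atTop)
        (f := fun (s : Finset ι) a => ∑ i ∈ s, F i a) (fun s => ?_) hf
      exact (integrable_finsetSum s fun i _ => hF i).aestronglyMeasurable
    · have h1 : ∫⁻ a, ‖f a‖ₑ ∂μ ≤ ∫⁻ a, ∑' i, ‖F i a‖ₑ ∂μ := by
        refine lintegral_mono_ae ?_
        filter_upwards [hf] with a ha
        rw [← ha.tsum_eq]
        exact enorm_tsum_le_tsum_enorm
      refine h1.trans_lt ?_
      rw [lintegral_tsum fun i => (hF i).aestronglyMeasurable.enorm]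
      have h2 : ∀ i, ∫⁻ a, ‖F i a‖ₑ ∂μ = ENNReal.ofReal (∫ a, ‖F i a‖ ∂μ) := fun i =>
        (ofReal_integral_norm_eq_lintegral_enorm (hF i)).symm
      simp_rw [h2]
      exact hsum.tsum_ofReal_lt_top
  · have h := hasSum_integral_of_summable_integral_norm hF hsum
    rwa [integral_congr_ae (g := f) (by filter_upwards [hf] with a ha using ha.tsum_eq)] at h

theorem integrableOn_Ioo_beta {u v : ℂ} (hu : 0 < u.re) (hv : 0 < v.re) :
    IntegrableOn (fun y : ℝ => (y : ℂ) ^ (u - 1) * (1 - (y : ℂ)) ^ (v - 1)) (Ioo 0 1) :=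
  (intervalIntegrable_iff_integrableOn_Ioo_of_le zero_le_one).1 (Complex.betaIntegral_convergent hu hv)

theorem setIntegral_Ioo_beta {u v : ℂ} (hu : 0 < u.re) (hv : 0 < v.re) :
    ∫ y : ℝ in Ioo 0 1, (y : ℂ) ^ (u - 1) * (1 - (y : ℂ)) ^ (v - 1) =
      Complex.Gamma u * Complex.Gamma v / Complex.Gamma (u + v) := by
  rw [← Complex.betaIntegral_eq_Gamma_mul_div u v hu hv, Complex.betaIntegral,
    intervalIntegral.integral_of_le zero_le_one, integral_Ioc_eq_integral_Ioo]

theorem norm_cpow_mul_one_sub_cpow (u v : ℂ) {y : ℝ} (hy : y ∈ Ioo (0 : ℝ) 1) :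
    ‖(y : ℂ) ^ u * (1 - (y : ℂ)) ^ v‖ = y ^ u.re * (1 - y) ^ v.re := by
  have h1 : (1 - (y : ℂ)) = ((1 - y : ℝ) : ℂ) := by push_cast; rfl
  rw [norm_mul, h1, Complex.norm_cpow_eq_rpow_re_of_pos hy.1,
    Complex.norm_cpow_eq_rpow_re_of_pos (sub_pos.2 hy.2)]

theorem setIntegral_Ioo_norm_beta {u v : ℂ} (hu : 0 < u.re) (hv : 0 < v.re) :
    ∫ y : ℝ in Ioo 0 1, ‖(y : ℂ) ^ (u - 1) * (1 - (y : ℂ)) ^ (v - 1)‖ =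
      ‖Complex.Gamma u.re * Complex.Gamma v.re / Complex.Gamma (u.re + v.re)‖ := by
  have hnn : 0 ≤ ∫ y : ℝ in Ioo 0 1, ‖(y : ℂ) ^ (u - 1) * (1 - (y : ℂ)) ^ (v - 1)‖ :=
    integral_nonneg fun _ => norm_nonneg _
  rw [← setIntegral_Ioo_beta (u := (u.re : ℂ)) (v := (v.re : ℂ)) (by simpa using hu)
    (by simpa using hv), ← Real.norm_of_nonneg hnn, ← Complex.norm_real, ← integral_complex_ofReal]
  congr 1
  refine setIntegral_congr_fun measurableSet_Ioo fun y hy => ?_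
  rw [norm_cpow_mul_one_sub_cpow _ _ hy, Complex.ofReal_mul, Complex.ofReal_cpow hy.1.le,
    Complex.ofReal_cpow (sub_nonneg.2 hy.2.le)]
  simp

theorem exists_norm_Gamma_div_Gamma_le {s g : ℂ} (hs : 0 < s.re) (hg : 0 < g.re) :
    ∃ C : ℝ, 0 < C ∧ ∀ N : ℕ, ‖Complex.Gamma s * Complex.Gamma (g + N) /
      Complex.Gamma (s + (g + N))‖ ≤ C * ((N : ℝ) + 1) ^ (-s.re) := by
  have hg' := ne_neg_nat_of_re_pos hg
  have hs' := ne_neg_nat_of_re_pos hs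
  have hsg := ne_neg_nat_of_re_pos (show 0 < (s + g).re by simp; linarith)
  obtain ⟨C, hC, h⟩ := exists_norm_poch_div_poch_zero_le g (s + g) hsg
  set D := Complex.Gamma s * Complex.Gamma g / Complex.Gamma (s + g) with hD
  have hD0 : D ≠ 0 := div_ne_zero (mul_ne_zero (Complex.Gamma_ne_zero hs')
    (Complex.Gamma_ne_zero hg')) (Complex.Gamma_ne_zero hsg)
  have hD1 : 0 < ‖D‖ := norm_pos_iff.2 hD0
  refine ⟨‖D‖ * C, by positivity, fun N => ?_⟩
  have e : Complex.Gamma s * Complex.Gamma (g + N) / Complex.Gamma (s + (g + N)) =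
      D * (poch g N / poch (s + g) N) := by
    rw [← add_assoc, Gamma_add_nat_eq_poch hg', Gamma_add_nat_eq_poch hsg, hD]
    ring
  rw [e, norm_mul, mul_assoc]
  have h1 := h N
  rw [show (g - (s + g)).re = -s.re by simp] at h1
  gcongr

/-- The integrand of the Mellin transform of the Marichev–Saigo–Maeda kernel on `(0, 1)`. -/
noncomputable def mellinKernel (α α' β β' γ s : ℂ) (y : ℝ) : ℂ :=
  (y : ℂ) ^ (s - 1) * (1 - (y : ℂ)) ^ (γ - 1) * kernelSeries α α' β β' γ (1 - y) (1 - y)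

/-- The value of the Mellin transform of the Marichev–Saigo–Maeda kernel. -/
noncomputable def mellinValue (α α' β β' γ s : ℂ) : ℂ :=
  Complex.Gamma γ * Complex.Gamma s * Complex.Gamma (s + β' - α') *
    Complex.Gamma (s + γ - α - α' - β) *
    ((Complex.Gamma (s + β'))⁻¹ * (Complex.Gamma (s + γ - α - α'))⁻¹ *
      (Complex.Gamma (s + γ - α' - β))⁻¹)

theorem norm_one_sub_ofReal_lt_one {y : ℝ} (hy : y ∈ Ioo (0 : ℝ) 1) : ‖1 - (y : ℂ)‖ < 1 := by
  have h1 : (1 - (y : ℂ)) = ((1 - y : ℝ) : ℂ) := by push_cast; rfl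
  rw [h1, Complex.norm_real, Real.norm_of_nonneg (by linarith [hy.2])]
  linarith [hy.1]

theorem one_sub_ofReal_ne_zero {y : ℝ} (hy : y ∈ Ioo (0 : ℝ) 1) : 1 - (y : ℂ) ≠ 0 := by
  have h1 : (1 - (y : ℂ)) = ((1 - y : ℝ) : ℂ) := by push_cast; rfl
  rw [h1]
  exact_mod_cast (sub_pos.2 hy.2).ne'

/-- Here `p` and `q` are the orders of growth of the partial sums in the two indices, and `-e` is the
decay in their sum. It suffices that `-e` exceeds `q + max p 0` only because `1 ≤ q`. -/
theorem summable_rpow_mul_rpow_mul_rpow {p q e : ℝ} (hq : 1 ≤ q) (he : e < -q) (hpe : e < -q - p) :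
    Summable fun i : ℕ × ℕ => ((i.1 : ℝ) + 1) ^ (p - 1) * ((i.2 : ℝ) + 1) ^ (q - 1) *
      ((i.1 : ℝ) + i.2 + 1) ^ e := by
  obtain ⟨ε, hε, hεe⟩ : ∃ ε : ℝ, 0 < ε ∧ e + q = -(max p 0 + ε) - ε := by
    refine ⟨(-e - q - max p 0) / 2, ?_, by ring⟩
    have : max p 0 < -e - q := max_lt (by linarith) (by linarith)
    linarith
  have hs := summable_nat_add_one_rpow (show -1 - ε < -1 by linarith)
  refine (hs.mul_of_nonneg hs (fun n => by positivity) (fun n => by positivity)).of_nonneg_of_le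
    (fun i => by positivity) fun ⟨m, n⟩ => ?_
  have hm : (0 : ℝ) < (m : ℝ) + 1 := by positivity
  have hn : (0 : ℝ) < (n : ℝ) + 1 := by positivity
  have hN : (0 : ℝ) < (m : ℝ) + n + 1 := by positivity
  have hmN : (m : ℝ) + 1 ≤ (m : ℝ) + n + 1 := by linarith
  have hnN : (n : ℝ) + 1 ≤ (m : ℝ) + n + 1 := by linarith
  have hp0 : 0 ≤ max p 0 := le_max_right _ _
  simp only
  calc ((m : ℝ) + 1) ^ (p - 1) * ((n : ℝ) + 1) ^ (q - 1) * ((m : ℝ) + n + 1) ^ e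
      ≤ ((m : ℝ) + 1) ^ (p - 1) * ((m : ℝ) + n + 1) ^ (q - 1) * ((m : ℝ) + n + 1) ^ e := by
        gcongr
    _ = ((m : ℝ) + 1) ^ (p - 1) * (((m : ℝ) + n + 1) ^ (-(max p 0 + ε)) *
          ((m : ℝ) + n + 1) ^ (-1 - ε)) := by
        rw [mul_assoc, ← Real.rpow_add hN, ← Real.rpow_add hN]
        congr 2
        linarith
    _ ≤ ((m : ℝ) + 1) ^ (max p 0 - 1) * (((m : ℝ) + 1) ^ (-(max p 0 + ε)) *
          ((n : ℝ) + 1) ^ (-1 - ε)) := by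
        have h1 : ((m : ℝ) + 1) ^ (p - 1) ≤ ((m : ℝ) + 1) ^ (max p 0 - 1) :=
          Real.rpow_le_rpow_of_exponent_le (by linarith [m.cast_nonneg (α := ℝ)])
            (by linarith [le_max_left p 0])
        have h2 : ((m : ℝ) + n + 1) ^ (-(max p 0 + ε)) ≤ ((m : ℝ) + 1) ^ (-(max p 0 + ε)) :=
          Real.rpow_le_rpow_of_nonpos hm hmN (by linarith)
        have h3 : ((m : ℝ) + n + 1) ^ (-1 - ε) ≤ ((n : ℝ) + 1) ^ (-1 - ε) :=
          Real.rpow_le_rpow_of_nonpos hn hnN (by linarith)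
        exact mul_le_mul h1 (mul_le_mul h2 h3 (by positivity) (by positivity)) (by positivity)
          (by positivity)
    _ = _ := by
        rw [← mul_assoc, ← Real.rpow_add hm]
        congr 2
        ring

/-- The Mellin transform of the kernel when `1 ≤ Re α'`: the double series can be integrated term by
term, and the resulting double series is summed by two applications of Gauss's theorem. -/
theorem mellinKernel_of_one_le_re {α α' β β' γ s : ℂ} (hα' : 1 ≤ α'.re) (hγ : 0 < γ.re)
    (hs : 0 < s.re) (hs₁ : (α + α' + β - γ).re < s.re) (hs₂ : (α' - β').re < s.re) :
    IntegrableOn (mellinKernel α α' β β' γ s) (Ioo 0 1) ∧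
      ∫ y in Ioo 0 1, mellinKernel α α' β β' γ s y = mellinValue α α' β β' γ s := by
  have hγ' := ne_neg_nat_of_re_pos hγ
  set F : ℕ × ℕ → ℝ → ℂ := fun i y => kernelCoeff α α' β β' γ i *
    ((y : ℂ) ^ (s - 1) * (1 - (y : ℂ)) ^ (γ + (i.1 + i.2 : ℕ) - 1)) with hF
  have hre : ∀ N : ℕ, 0 < (γ + N).re := fun N => by simp; positivity
  have hFint : ∀ i, IntegrableOn (F i) (Ioo 0 1) := fun i =>
    (integrableOn_Ioo_beta hs (hre _)).const_mul _
  have hsum : Summable fun i => ∫ y in Ioo 0 1, ‖F i y‖ := by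
    obtain ⟨C, hC, hk⟩ := exists_norm_kernelCoeff_le α α' β β' hγ'
    obtain ⟨D, hD, hB⟩ := exists_norm_Gamma_div_Gamma_le (s := (s.re : ℂ)) (g := (γ.re : ℂ))
      (by simpa using hs) (by simpa using hγ)
    have h := summable_rpow_mul_rpow_mul_rpow (p := (α + β + β' - γ).re) (q := α'.re)
      (e := -β'.re - s.re) hα' (by simp at hs₂ ⊢; linarith) (by simp at hs₁ ⊢; linarith)
    refine (h.mul_left (C * D)).of_nonneg_of_le (fun i => integral_nonneg fun _ => norm_nonneg _)
      fun ⟨m, n⟩ => ?_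
    simp only [hF]
    simp_rw [norm_mul (kernelCoeff α α' β β' γ (m, n))]
    rw [integral_const_mul, setIntegral_Ioo_norm_beta hs (hre _)]
    have hb := hB (m + n)
    have hmn : (0 : ℝ) < (m : ℝ) + n + 1 := by positivity
    rw [show (((γ + (m + n : ℕ)).re : ℝ) : ℂ) = (γ.re : ℂ) + (m + n : ℕ) by simp]
    calc _ ≤ C * (((m : ℝ) + 1) ^ ((α + β + β' - γ).re - 1) * ((n : ℝ) + 1) ^ (α'.re - 1) *
          ((m : ℝ) + n + 1) ^ (-β'.re)) * (D * (((m + n : ℕ) : ℝ) + 1) ^ (-s.re)) := by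
          gcongr
          · exact hk m n
          · simpa using hb
      _ = _ := by
          rw [sub_eq_add_neg (-β'.re), Real.rpow_add hmn]
          push_cast
          ring
  have hlim : ∀ᵐ y ∂(volume.restrict (Ioo (0 : ℝ) 1)),
      HasSum (fun i => F i y) (mellinKernel α α' β β' γ s y) := by
    filter_upwards [ae_restrict_mem measurableSet_Ioo] with y hy
    have hw := norm_one_sub_ofReal_lt_one hy
    have h := (summable_kernelSeries α α' β β' hγ' hw hw).hasSum.mul_left
      ((y : ℂ) ^ (s - 1) * (1 - (y : ℂ)) ^ (γ - 1))
    refine h.congr_fun fun i => ?_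
    simp only [hF]
    rw [show γ + (i.1 + i.2 : ℕ) - 1 = γ - 1 + (i.1 + i.2 : ℕ) by ring,
      Complex.cpow_add _ _ (one_sub_ofReal_ne_zero hy), Complex.cpow_natCast, pow_add]
    ring
  obtain ⟨hint, hS⟩ := integrable_and_hasSum_integral_of_summable hFint hsum hlim
  refine ⟨hint, ?_⟩
  rw [← hS.tsum_eq, hS.summable.tsum_prod]
  have hrow : ∀ m : ℕ, ∑' n : ℕ, ∫ y in Ioo 0 1, F (m, n) y =
      Complex.Gamma s * Complex.Gamma γ * Complex.Gamma (s + β' - α') *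
        (Complex.Gamma (s + β'))⁻¹ * gaussTerm α β (s + γ - α') m := by
    intro m
    have e1 : ∀ n : ℕ, ∫ y in Ioo 0 1, F (m, n) y = Complex.Gamma s * Complex.Gamma γ *
        (poch α m * poch β m / (m.factorial : ℂ)) *
          gaussTerm α' (γ + m - β') (s + γ + m) n := by
      intro n
      simp only [hF]
      rw [integral_const_mul, setIntegral_Ioo_beta hs (hre _), Gamma_add_nat_eq_poch hγ',
        kernelCoeff, gaussTerm, show s + (γ + (m + n : ℕ)) = s + γ + m + n by push_cast; ring]
      have h1 := poch_ne_zero hγ' (m + n)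
      field_simp
    simp_rw [e1]
    rw [tsum_mul_left, (hasSum_gaussTerm (a := α') (b := γ + m - β') (c := s + γ + m) (by
      simp at hs₂ ⊢; linarith)).tsum_eq, gaussTerm,
      show s + γ + m - α' - (γ + m - β') = s + β' - α' by ring,
      show s + γ + m - (γ + m - β') = s + β' by ring,
      show s + γ + m - α' = s + γ - α' + m by ring]
    ring
  simp_rw [hrow]
  rw [tsum_mul_left, (hasSum_gaussTerm (a := α) (b := β) (c := s + γ - α') (by
      simp at hs₁ ⊢; linarith)).tsum_eq, mellinValue,
    show s + γ - α' - α - β = s + γ - α - α' - β by ring,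
    show s + γ - α' - α = s + γ - α - α' by ring]
  ring

/-- A contiguous relation that raises `α'`, from summation by parts in the second index. -/
theorem kernelSeries_contiguous (α α' β β' : ℂ) {γ u z : ℂ} (hγ : ∀ n : ℕ, γ ≠ -(n : ℂ))
    (hu : ‖u‖ < 1) (hz : ‖z‖ < 1) :
    kernelSeries α α' β β' γ u z = (1 - z) * kernelSeries α (α' + 1) β β' γ u z +
      β' / γ * (z * kernelSeries α (α' + 1) β (β' + 1) (γ + 1) u z) := by
  have hγ1 : ∀ n : ℕ, γ + 1 ≠ -(n : ℂ) := fun n => by simpa using add_nat_ne_neg_nat hγ 1 n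
  have hf := summable_kernelSeries α α' β β' hγ hu hz
  have hg := summable_kernelSeries α (α' + 1) β β' hγ hu hz
  have hh := summable_kernelSeries α (α' + 1) β (β' + 1) hγ1 hu hz
  simp only [kernelSeries]
  rw [hf.tsum_prod, hg.tsum_prod, hh.tsum_prod, ← tsum_mul_left, ← tsum_mul_left, ← tsum_mul_left,
    ← (hg.prod.mul_left (1 - z)).tsum_add ((hh.prod.mul_left z).mul_left (β' / γ))]
  refine tsum_congr fun m => ?_
  set f : ℕ → ℂ := fun n => kernelCoeff α α' β β' γ (m, n) * u ^ m * z ^ n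
  set g : ℕ → ℂ := fun n => kernelCoeff α (α' + 1) β β' γ (m, n) * u ^ m * z ^ n
  set h : ℕ → ℂ := fun n => kernelCoeff α (α' + 1) β (β' + 1) (γ + 1) (m, n) * u ^ m * z ^ n
  have sf : Summable f := hf.prod_factor m
  have sg : Summable g := hg.prod_factor m
  have sh : Summable h := hh.prod_factor m
  have h0 : f 0 = g 0 := by simp [f, g, kernelCoeff]
  -- `(α' + 1)ₙ₊₁ / (n + 1)! - (α')ₙ₊₁ / (n + 1)! = (α' + 1)ₙ / n!`.
  have hstep : ∀ n, f (n + 1) = g (n + 1) - (z * g n - β' / γ * (z * h n)) := by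
    intro n
    have e1 : γ * poch (γ + 1) (m + n) = poch γ (m + n) * (γ + (m + n : ℕ)) := by
      rw [← poch_succ_left, poch_succ]
    have e2 := poch_ne_zero hγ (m + n)
    have e3 := poch_ne_zero hγ1 (m + n)
    have e4 : γ + (m + n : ℕ) ≠ 0 := fun h => hγ (m + n) (eq_neg_of_add_eq_zero_left h)
    have e5 : γ ≠ 0 := by simpa using hγ 0
    have e6 : (m.factorial : ℂ) ≠ 0 := by exact_mod_cast m.factorial_ne_zero
    have e7 : (n.factorial : ℂ) ≠ 0 := by exact_mod_cast n.factorial_ne_zero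
    have e8 : (n : ℂ) + 1 ≠ 0 := by exact_mod_cast n.succ_ne_zero
    have e9 : poch (γ + 1) (m + n) = poch γ (m + n) * (γ + (m + n : ℕ)) / γ := by
      rw [← e1]; field_simp
    simp only [f, g, h, kernelCoeff, Nat.factorial_succ]
    rw [← add_assoc m n 1, e9, poch_succ γ, poch_succ_left α', poch_succ (α' + 1),
      poch_succ (γ + m - β'), show γ + 1 + m - (β' + 1) = γ + m - β' by ring]
    push_cast at e4 ⊢
    field_simp
    ring
  rw [sf.tsum_eq_zero_add, h0]
  simp_rw [hstep]
  have sg1 : Summable fun n => g (n + 1) := (summable_nat_add_iff (f := g) 1).2 sg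
  rw [sg1.tsum_sub ((sg.mul_left z).sub ((sh.mul_left z).mul_left (β' / γ))),
    (sg.mul_left z).tsum_sub ((sh.mul_left z).mul_left (β' / γ)), tsum_mul_left, tsum_mul_left,
    tsum_mul_left, ← add_sub_assoc, ← sg.tsum_eq_zero_add]
  ring

theorem mellinKernel_contiguous (α α' β β' s : ℂ) {γ : ℂ} (hγ : ∀ n : ℕ, γ ≠ -(n : ℂ)) {y : ℝ}
    (hy : y ∈ Ioo (0 : ℝ) 1) :
    mellinKernel α α' β β' γ s y = mellinKernel α (α' + 1) β β' γ (s + 1) y +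
      β' / γ * mellinKernel α (α' + 1) β (β' + 1) (γ + 1) s y := by
  have hw := norm_one_sub_ofReal_lt_one hy
  have h1 := one_sub_ofReal_ne_zero hy
  have h0 : (y : ℂ) ≠ 0 := by exact_mod_cast hy.1.ne'
  simp only [mellinKernel]
  rw [kernelSeries_contiguous α α' β β' hγ hw hw, show s + 1 - 1 = s - 1 + 1 by ring,
    show γ + 1 - 1 = γ - 1 + 1 by ring, Complex.cpow_add _ _ h0, Complex.cpow_add _ _ h1,
    Complex.cpow_one, Complex.cpow_one]
  ring

theorem mellinValue_contiguous (α α' β β' : ℂ) {γ s : ℂ} (hγ : γ ≠ 0) (hs : s ≠ 0) :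
    mellinValue α α' β β' γ s = mellinValue α (α' + 1) β β' γ (s + 1) +
      β' / γ * mellinValue α (α' + 1) β (β' + 1) (γ + 1) s := by
  simp only [mellinValue]
  rw [Complex.Gamma_add_one s hs, Complex.Gamma_add_one γ hγ,
    inv_Gamma_eq_mul_inv_Gamma_add_one (s + β'),
    show s + 1 + β' - (α' + 1) = s + β' - α' by ring,
    show s + (β' + 1) - (α' + 1) = s + β' - α' by ring,
    show s + 1 + γ - α - (α' + 1) = s + γ - α - α' by ring,
    show s + (γ + 1) - α - (α' + 1) = s + γ - α - α' by ring,
    show s + 1 + γ - (α' + 1) - β = s + γ - α' - β by ring,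
    show s + (γ + 1) - (α' + 1) - β = s + γ - α' - β by ring,
    show s + 1 + β' = s + β' + 1 by ring, show s + (β' + 1) = s + β' + 1 by ring]
  field_simp

/-- **The Mellin transform of the Marichev–Saigo–Maeda kernel.** The double series cannot be
integrated termwise when `Re α' < 0`; the contiguous relation reduces this to `1 ≤ Re α'`. -/
theorem mellinKernel_integral {α α' β β' γ s : ℂ} (hγ : 0 < γ.re) (hs : 0 < s.re)
    (hs₁ : (α + α' + β - γ).re < s.re) (hs₂ : (α' - β').re < s.re) :
    IntegrableOn (mellinKernel α α' β β' γ s) (Ioo 0 1) ∧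
      ∫ y in Ioo 0 1, mellinKernel α α' β β' γ s y = mellinValue α α' β β' γ s := by
  -- The relation keeps the admissible half-plane: it raises either `s`, or `β'` and `γ`, by `1`
  -- along with `α'`.
  obtain ⟨k, hk⟩ := exists_nat_ge (1 - α'.re)
  induction k generalizing α' β' γ s with
  | zero => exact mellinKernel_of_one_le_re (by simp at hk; linarith) hγ hs hs₁ hs₂
  | succ k ih =>
    push_cast at hk
    have hk' : 1 - (α' + 1).re ≤ k := by simp; linarith
    obtain ⟨i1, v1⟩ := ih (α' := α' + 1) (β' := β') (γ := γ) (s := s + 1) hγ (by simp; linarith)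
      (by simp at hs₁ ⊢; linarith) (by simp at hs₂ ⊢; linarith) hk'
    obtain ⟨i2, v2⟩ := ih (α' := α' + 1) (β' := β' + 1) (γ := γ + 1) (s := s) (by simp; linarith) hs
      (by simp at hs₁ ⊢; linarith) (by simp at hs₂ ⊢; linarith) hk'
    have hγ0 : γ ≠ 0 := by rintro rfl; simp at hγ
    have hs0 : s ≠ 0 := by rintro rfl; simp at hs
    have hEq : EqOn (fun y => mellinKernel α (α' + 1) β β' γ (s + 1) y +
        β' / γ * mellinKernel α (α' + 1) β (β' + 1) (γ + 1) s y)
        (mellinKernel α α' β β' γ s) (Ioo 0 1) := fun y hy =>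
      (mellinKernel_contiguous α α' β β' s (ne_neg_nat_of_re_pos hγ) hy).symm
    refine ⟨(i1.add (i2.const_mul (β' / γ))).congr_fun hEq measurableSet_Ioo, ?_⟩
    rw [← setIntegral_congr_fun measurableSet_Ioo hEq, integral_add i1 (i2.const_mul _),
      integral_const_mul, v1, v2, ← mellinValue_contiguous α α' β β' hγ0 hs0]

/-! ### Termwise integration of the Bessel series -/

theorem summable_besselCoeff (c κ : ℂ) (r : ℝ) :
    Summable fun k : ℕ =>
      ‖(-1) ^ k * c ^ k / (Complex.Gamma (κ + k) * (k.factorial : ℂ))‖ * r ^ k := by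
  obtain ⟨C, hC, h⟩ := exists_norm_factorial_mul_inv_Gamma_le κ
  have hs := (summable_rpow_mul_geometric (1 - κ.re) (show (0 : ℝ) ≤ 1 / 2 by norm_num)
    (by norm_num)).mul_left (C * Real.exp (2 * (‖c‖ * |r|)))
  refine Summable.of_norm_bounded hs fun k => ?_
  have hf : (1 : ℝ) ≤ (k.factorial : ℝ) := by exact_mod_cast k.factorial_pos
  have hfC : (k.factorial : ℂ) ≠ 0 := by exact_mod_cast k.factorial_ne_zero
  have e1 : (-1) ^ k * c ^ k / (Complex.Gamma (κ + k) * (k.factorial : ℂ)) =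
      (k.factorial : ℂ) * (Complex.Gamma (κ + k))⁻¹ *
        ((-1) ^ k * (c ^ k / ((k.factorial : ℂ) * (k.factorial : ℂ)))) := by
    field_simp
  have e2 : (‖c‖ * |r|) ^ k / (k.factorial : ℝ) ≤
      Real.exp (2 * (‖c‖ * |r|)) * (1 / 2) ^ k := by
    have h1 := Real.pow_div_factorial_le_exp (2 * (‖c‖ * |r|)) (by positivity) k
    calc (‖c‖ * |r|) ^ k / (k.factorial : ℝ) =
        (2 * (‖c‖ * |r|)) ^ k / (k.factorial : ℝ) * (1 / 2) ^ k := by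
          rw [mul_pow 2, div_pow, one_pow]
          field_simp
      _ ≤ _ := by gcongr
  rw [e1, norm_mul, norm_norm, norm_mul, norm_mul ((-1) ^ k), norm_pow (-1), norm_neg, norm_one,
    one_pow, one_mul, norm_div, norm_mul (k.factorial : ℂ) (k.factorial : ℂ), norm_pow, norm_pow,
    Complex.norm_natCast, Real.norm_eq_abs]
  calc _ ≤ C * ((k : ℝ) + 1) ^ (1 - κ.re) * (‖c‖ ^ k / ((k.factorial : ℝ) * 1)) * |r| ^ k := by
        gcongr
        exact h k
    _ = C * ((k : ℝ) + 1) ^ (1 - κ.re) * ((‖c‖ * |r|) ^ k / (k.factorial : ℝ)) := by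
        rw [mul_pow]
        ring
    _ ≤ C * ((k : ℝ) + 1) ^ (1 - κ.re) * (Real.exp (2 * (‖c‖ * |r|)) * (1 / 2) ^ k) := by
        gcongr
    _ = _ := by ring

theorem mellinKernel_add_nat (α α' β β' γ s : ℂ) (n : ℕ) {y : ℝ} (hy : y ≠ 0) :
    mellinKernel α α' β β' γ (s + n) y = (y : ℂ) ^ n * mellinKernel α α' β β' γ s y := by
  have h0 : (y : ℂ) ≠ 0 := by exact_mod_cast hy
  simp only [mellinKernel]
  rw [show s + n - 1 = s - 1 + n by ring, Complex.cpow_add _ _ h0, Complex.cpow_natCast]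
  ring

theorem div_two_cpow (p : ℂ) (k : ℕ) {x : ℝ} (hx : 0 < x) :
    ((x : ℂ) / 2) ^ (2 * (k : ℂ) + p) = ((x : ℂ) ^ 2 / 4) ^ k * ((x : ℂ) ^ p / (2 : ℂ) ^ p) := by
  have h0 : (x : ℂ) / 2 ≠ 0 := by
    have : (x : ℂ) ≠ 0 := by exact_mod_cast hx.ne'
    simpa using this
  have h1 : (x : ℂ) ^ p = ((x : ℂ) / 2) ^ p * (2 : ℂ) ^ p := by
    have h := Complex.mul_cpow_ofReal_nonneg (a := x / 2) (b := 2) (by positivity) (by norm_num) p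
    push_cast at h
    rwa [div_mul_cancel₀ _ (two_ne_zero)] at h
  have h2 : (2 : ℂ) ^ p ≠ 0 := by simp [Complex.cpow_eq_zero_iff]
  have h3 : (2 * (k : ℂ)) = ((2 * k : ℕ) : ℂ) := by push_cast; rfl
  rw [Complex.cpow_add _ _ h0, h1, mul_div_cancel_right₀ _ h2, h3, Complex.cpow_natCast, pow_mul,
    div_pow]
  norm_num

theorem norm_div_two_cpow (p : ℂ) (k : ℕ) {x : ℝ} (hx : 0 < x) :
    ‖((x : ℂ) / 2) ^ (2 * (k : ℂ) + p)‖ = (x ^ 2 / 4) ^ k * ‖(x : ℂ) ^ p / (2 : ℂ) ^ p‖ := by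
  rw [div_two_cpow p k hx, norm_mul, norm_pow, norm_div ((x : ℂ) ^ 2), norm_pow, Complex.norm_real,
    Complex.norm_ofNat, Real.norm_of_nonneg hx.le]

theorem integral_mellinKernel_mul_besselW {α α' β β' γ ρ p b c : ℂ} (hγ : 0 < γ.re)
    (hs : 0 < (ρ + p).re) (hs₁ : (α + α' + β - γ).re < (ρ + p).re)
    (hs₂ : (α' - β').re < (ρ + p).re) {x : ℝ} (hx : 0 < x) :
    IntegrableOn (fun y : ℝ => mellinKernel α α' β β' γ ρ y * besselW p b c ((x * y : ℝ) : ℂ))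
        (Ioo 0 1) ∧
      HasSum (fun k : ℕ => (-1) ^ k * c ^ k /
          (Complex.Gamma (p + (b + 1) / 2 + k) * (k.factorial : ℂ)) *
          ((x : ℂ) / 2) ^ (2 * (k : ℂ) + p) * mellinValue α α' β β' γ (ρ + p + (2 * k : ℕ)))
        (∫ y in Ioo 0 1, mellinKernel α α' β β' γ ρ y * besselW p b c ((x * y : ℝ) : ℂ)) := by
  set w : ℕ → ℂ := fun k => (-1) ^ k * c ^ k /
    (Complex.Gamma (p + (b + 1) / 2 + k) * (k.factorial : ℂ)) with hw
  have hre : ∀ k : ℕ, (ρ + p).re ≤ (ρ + p + (2 * k : ℕ)).re := fun k => by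
    simp
  have hM : ∀ k : ℕ, IntegrableOn (mellinKernel α α' β β' γ (ρ + p + (2 * k : ℕ))) (Ioo 0 1) ∧
      ∫ y in Ioo 0 1, mellinKernel α α' β β' γ (ρ + p + (2 * k : ℕ)) y =
        mellinValue α α' β β' γ (ρ + p + (2 * k : ℕ)) := fun k =>
    mellinKernel_integral hγ (hs.trans_le (hre k)) (hs₁.trans_le (hre k)) (hs₂.trans_le (hre k))
  have hM0 : IntegrableOn (mellinKernel α α' β β' γ (ρ + p)) (Ioo 0 1) := by
    simpa using (hM 0).1
  set F : ℕ → ℝ → ℂ := fun k y => w k * ((x : ℂ) / 2) ^ (2 * (k : ℂ) + p) *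
    mellinKernel α α' β β' γ (ρ + p + (2 * k : ℕ)) y with hF
  have hw1 : ∀ r : ℝ, Summable fun k => ‖w k‖ * r ^ k := fun r =>
    summable_besselCoeff c (p + (b + 1) / 2) r
  have hFint : ∀ k, IntegrableOn (F k) (Ioo 0 1) := fun k => (hM k).1.const_mul _
  have hsum : Summable fun k => ∫ y in Ioo 0 1, ‖F k y‖ := by
    refine ((hw1 (x ^ 2 / 4)).mul_right (‖(x : ℂ) ^ p / (2 : ℂ) ^ p‖ *
      ∫ y in Ioo 0 1, ‖mellinKernel α α' β β' γ (ρ + p) y‖)).of_nonneg_of_le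
      (fun k => integral_nonneg fun _ => norm_nonneg _) fun k => ?_
    have e1 : ‖w k * ((x : ℂ) / 2) ^ (2 * (k : ℂ) + p)‖ =
        ‖w k‖ * (x ^ 2 / 4) ^ k * ‖(x : ℂ) ^ p / (2 : ℂ) ^ p‖ := by
      rw [norm_mul, norm_div_two_cpow p k hx, mul_assoc]
    simp only [hF]
    simp_rw [norm_mul (w k * ((x : ℂ) / 2) ^ (2 * (k : ℂ) + p))]
    rw [integral_const_mul, e1, ← mul_assoc]
    refine mul_le_mul_of_nonneg_left ?_ (by positivity)
    refine setIntegral_mono_on (hM k).1.norm hM0.norm measurableSet_Ioo fun y hy => ?_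
    rw [mellinKernel_add_nat _ _ _ _ _ _ _ hy.1.ne', norm_mul, norm_pow, Complex.norm_real,
      Real.norm_of_nonneg hy.1.le]
    exact mul_le_of_le_one_left (norm_nonneg _) (pow_le_one₀ hy.1.le hy.2.le)
  have hlim : ∀ᵐ y ∂(volume.restrict (Ioo (0 : ℝ) 1)), HasSum (fun k => F k y)
      (mellinKernel α α' β β' γ ρ y * besselW p b c ((x * y : ℝ) : ℂ)) := by
    filter_upwards [ae_restrict_mem measurableSet_Ioo] with y hy
    have hxy : 0 < x * y := mul_pos hx hy.1
    have hy0 : (y : ℂ) ≠ 0 := by exact_mod_cast hy.1.ne'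
    have h1 : Summable fun k : ℕ => w k * (((x * y : ℝ) : ℂ) / 2) ^ (2 * (k : ℂ) + p) := by
      refine Summable.of_norm (((hw1 ((x * y) ^ 2 / 4)).mul_right
        ‖((x * y : ℝ) : ℂ) ^ p / (2 : ℂ) ^ p‖).congr fun k => ?_)
      rw [norm_mul, norm_div_two_cpow p k hxy, mul_assoc]
    refine (h1.hasSum.mul_left (mellinKernel α α' β β' γ ρ y)).congr_fun fun k => ?_
    have e2 : (((x * y : ℝ) : ℂ) / 2) ^ (2 * (k : ℂ) + p) =
        ((x : ℂ) / 2) ^ (2 * (k : ℂ) + p) * (y : ℂ) ^ (2 * (k : ℂ) + p) := by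
      have h := Complex.mul_cpow_ofReal_nonneg (a := x / 2) (b := y) (by positivity) hy.1.le
        (2 * (k : ℂ) + p)
      push_cast at h ⊢
      rw [← h]
      congr 1
      ring
    simp only [hF, mellinKernel]
    rw [e2, show ρ + p + (2 * k : ℕ) - 1 = ρ - 1 + (2 * (k : ℂ) + p) by push_cast; ring,
      Complex.cpow_add _ _ hy0]
    ring
  obtain ⟨hint, hS⟩ := integrable_and_hasSum_integral_of_summable hFint hsum hlim
  refine ⟨hint, hS.congr_fun fun k => ?_⟩
  simp only [hF]
  rw [integral_const_mul, (hM k).2]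

/-- On `(0, x)` the integrand is a rescaled Mellin integrand. For `u = 1 - t / x` and `v = 1 - x / t`
one has `v / (v - 1) = u`, and the power `(1 - v) ^ (-α')` cancels `t ^ (-α')`. -/
theorem msmIntegrand_eq (α α' β β' ρ : ℂ) {γ : ℂ} (hγ : ∀ n : ℕ, γ ≠ -(n : ℂ)) (g : ℂ → ℂ)
    {x t : ℝ} (ht : t ∈ Ioo 0 x) :
    msmIntegrand α α' β β' γ (fun t : ℝ => (t : ℂ) ^ (ρ - 1) * g t) x t =
      (x : ℂ) ^ (γ - 1) * (x : ℂ) ^ (-α') * (x : ℂ) ^ (ρ - 1) *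
        (mellinKernel α α' β β' γ ρ (t / x) * g ((x * (t / x) : ℝ) : ℂ)) := by
  have ht0 : 0 < t := ht.1
  have hx : 0 < x := ht.1.trans ht.2
  have hy : t / x ∈ Ioo (0 : ℝ) 1 := ⟨by positivity, (div_lt_one hx).2 ht.2⟩
  have hv : ((1 - x / t : ℝ) : ℂ).re < 1 / 2 := by
    rw [Complex.ofReal_re]
    have : 1 < x / t := (one_lt_div ht0).2 ht.2
    linarith
  have hu : ‖((1 - t / x : ℝ) : ℂ)‖ < 1 := by
    have := norm_one_sub_ofReal_lt_one hy
    push_cast at this ⊢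
    exact this
  have e1 : ((1 - x / t : ℝ) : ℂ) / (((1 - x / t : ℝ) : ℂ) - 1) = 1 - ((t / x : ℝ) : ℂ) := by
    have h1 : (x : ℂ) ≠ 0 := by exact_mod_cast hx.ne'
    have h2 : (t : ℂ) ≠ 0 := by exact_mod_cast ht0.ne'
    have h3 : ((1 - x / t : ℝ) : ℂ) - 1 = -(x / t) := by push_cast; ring
    rw [h3]
    push_cast
    field_simp
    ring
  have e2 : (t : ℂ) ^ (-α') * (1 - ((1 - x / t : ℝ) : ℂ)) ^ (-α') = (x : ℂ) ^ (-α') := by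
    have h1 : 1 - ((1 - x / t : ℝ) : ℂ) = ((x / t : ℝ) : ℂ) := by push_cast; ring
    rw [h1, ← Complex.mul_cpow_ofReal_nonneg ht0.le (by positivity), ← Complex.ofReal_mul,
      mul_div_cancel₀ _ ht0.ne']
  have e3 : ((x - t : ℝ) : ℂ) ^ (γ - 1) =
      (x : ℂ) ^ (γ - 1) * (1 - ((t / x : ℝ) : ℂ)) ^ (γ - 1) := by
    have h1 : 1 - ((t / x : ℝ) : ℂ) = ((1 - t / x : ℝ) : ℂ) := by push_cast; rfl
    rw [h1, ← Complex.mul_cpow_ofReal_nonneg hx.le (by linarith [hy.2]), ← Complex.ofReal_mul]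
    congr 2
    field_simp
  have e4 : (t : ℂ) ^ (ρ - 1) = (x : ℂ) ^ (ρ - 1) * ((t / x : ℝ) : ℂ) ^ (ρ - 1) := by
    rw [← Complex.mul_cpow_ofReal_nonneg hx.le hy.1.le, ← Complex.ofReal_mul,
      mul_div_cancel₀ _ hx.ne']
  rw [msmIntegrand, appellF3_eq_kernelSeries α α' β β' hγ hu hv, e1, e3, e4, mellinKernel,
    mul_div_cancel₀ _ hx.ne', ← e2, show ((1 - t / x : ℝ) : ℂ) = 1 - ((t / x : ℝ) : ℂ) by
      push_cast; rfl]
  ring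

/-- The shift of the Mellin transform by `2 k`: each quotient of Gamma functions is a Pochhammer
symbol of index `2 k`, which splits into two of index `k`. -/
theorem mellinValue_add_two_mul {α α' β β' γ s : ℂ} (hs : 0 < s.re)
    (hs₁ : 0 < (s + γ - α - α' - β).re) (hs₂ : 0 < (s + β' - α').re)
    (h₁ : ∀ n : ℕ, s + β' ≠ -(n : ℂ)) (h₂ : ∀ n : ℕ, s + γ - α - α' ≠ -(n : ℂ))
    (h₃ : ∀ n : ℕ, s + γ - α' - β ≠ -(n : ℂ)) (k : ℕ) :
    mellinValue α α' β β' γ (s + (2 * k : ℕ)) = mellinValue α α' β β' γ s *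
      (poch (s / 2) k * poch ((s + 1) / 2) k *
        (poch ((s + γ - α - α' - β) / 2) k * poch ((s + γ - α - α' - β + 1) / 2) k) *
        (poch ((s + β' - α') / 2) k * poch ((s + β' - α' + 1) / 2) k) /
        (poch ((s + β') / 2) k * poch ((s + β' + 1) / 2) k *
        (poch ((s + γ - α - α') / 2) k * poch ((s + γ - α - α' + 1) / 2) k) *
        (poch ((s + γ - α' - β) / 2) k * poch ((s + γ - α' - β + 1) / 2) k))) := by
  simp only [mellinValue]
  rw [show s + (2 * k : ℕ) + β' - α' = s + β' - α' + (2 * k : ℕ) by ring,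
    show s + (2 * k : ℕ) + γ - α - α' - β = s + γ - α - α' - β + (2 * k : ℕ) by ring,
    show s + (2 * k : ℕ) + β' = s + β' + (2 * k : ℕ) by ring,
    show s + (2 * k : ℕ) + γ - α - α' = s + γ - α - α' + (2 * k : ℕ) by ring,
    show s + (2 * k : ℕ) + γ - α' - β = s + γ - α' - β + (2 * k : ℕ) by ring,
    Gamma_add_nat_eq_poch (ne_neg_nat_of_re_pos hs), Gamma_add_nat_eq_poch (ne_neg_nat_of_re_pos hs₁),
    Gamma_add_nat_eq_poch (ne_neg_nat_of_re_pos hs₂), Gamma_add_nat_eq_poch h₁,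
    Gamma_add_nat_eq_poch h₂, Gamma_add_nat_eq_poch h₃]
  have hfrac : poch s (2 * k) * poch (s + γ - α - α' - β) (2 * k) * poch (s + β' - α') (2 * k) /
      (poch (s + β') (2 * k) * poch (s + γ - α - α') (2 * k) * poch (s + γ - α' - β) (2 * k)) =
      poch (s / 2) k * poch ((s + 1) / 2) k *
        (poch ((s + γ - α - α' - β) / 2) k * poch ((s + γ - α - α' - β + 1) / 2) k) *
        (poch ((s + β' - α') / 2) k * poch ((s + β' - α' + 1) / 2) k) /
        (poch ((s + β') / 2) k * poch ((s + β' + 1) / 2) k *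
        (poch ((s + γ - α - α') / 2) k * poch ((s + γ - α - α' + 1) / 2) k) *
        (poch ((s + γ - α' - β) / 2) k * poch ((s + γ - α' - β + 1) / 2) k)) := by
    have h4 : (4 : ℂ) ^ k * 4 ^ k * 4 ^ k ≠ 0 := by simp
    symm
    rw [← mul_div_mul_left _ _ h4]
    simp only [poch_two_mul]
    congr 1 <;> ring
  rw [← hfrac, div_eq_mul_inv]
  simp only [mul_inv]
  ring

theorem theorem3 (α α' β β' γ ρ p b c κ : ℂ)
    (hκ : κ = p + (b + 1) / 2) (hκ0 : ∀ n : ℕ, κ ≠ -(n : ℂ))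
    (hγ : 0 < γ.re)
    (hρ : max 0 (max (α + α' + β - γ).re (α' - β').re) < (ρ + p).re)
    (h₁ : ∀ n : ℕ, ρ + p + β' ≠ -(n : ℂ))
    (h₂ : ∀ n : ℕ, ρ + p + γ - α - α' ≠ -(n : ℂ))
    (h₃ : ∀ n : ℕ, ρ + p + γ - α' - β ≠ -(n : ℂ))
    (x : ℝ) (hx : 0 < x) :
    IntervalIntegrable
        (msmIntegrand α α' β β' γ (fun t : ℝ => (t : ℂ) ^ (ρ - 1) * besselW p b c (t : ℂ)) x)
        MeasureTheory.volume 0 x ∧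
      msmIntegral α α' β β' γ (fun t : ℝ => (t : ℂ) ^ (ρ - 1) * besselW p b c (t : ℂ)) x =
        (x : ℂ) ^ (ρ + p - α - α' + γ - 1) / (2 : ℂ) ^ p *
          (Complex.Gamma (ρ + p) * Complex.Gamma (ρ + p + γ - α - α' - β) *
              Complex.Gamma (ρ + p + β' - α') /
            (Complex.Gamma (ρ + p + β') * Complex.Gamma (ρ + p + γ - α - α') *
              Complex.Gamma (ρ + p + γ - α' - β) * Complex.Gamma κ)) *
          genHypergeometric
            [(ρ + p) / 2, (ρ + p + 1) / 2,
              (ρ + p + γ - α - α' - β) / 2, (ρ + p + γ - α - α' - β + 1) / 2,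
              (ρ + p + β' - α') / 2, (ρ + p + β' - α' + 1) / 2]
            [κ, (ρ + p + β') / 2, (ρ + p + β' + 1) / 2,
              (ρ + p + γ - α - α') / 2, (ρ + p + γ - α - α' + 1) / 2,
              (ρ + p + γ - α' - β) / 2, (ρ + p + γ - α' - β + 1) / 2]
            (-(c * (x : ℂ) ^ 2) / 4) := by
  have hγ' := ne_neg_nat_of_re_pos hγ
  obtain ⟨hs, hs12⟩ := max_lt_iff.1 hρ
  obtain ⟨hs₁, hs₂⟩ := max_lt_iff.1 hs12
  obtain ⟨hint, hS⟩ := integral_mellinKernel_mul_besselW (b := b) (c := c) hγ hs hs₁ hs₂ hx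
  set Ψ : ℝ → ℂ := fun y => mellinKernel α α' β β' γ ρ y * besselW p b c ((x * y : ℝ) : ℂ) with hΨ
  set X : ℂ := (x : ℂ) ^ (γ - 1) * (x : ℂ) ^ (-α') * (x : ℂ) ^ (ρ - 1) with hX
  have hEq : EqOn (fun t => X * Ψ (t / x))
      (msmIntegrand α α' β β' γ (fun t : ℝ => (t : ℂ) ^ (ρ - 1) * besselW p b c (t : ℂ)) x)
      (Ioo 0 x) := fun t ht => (msmIntegrand_eq α α' β β' ρ hγ' (besselW p b c) ht).symm
  have hΨint : IntervalIntegrable Ψ volume 0 1 :=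
    (intervalIntegrable_iff_integrableOn_Ioo_of_le zero_le_one).2 hint
  have hΨx : IntervalIntegrable (fun t => X * Ψ (t / x)) volume 0 x := by
    have h := (hΨint.comp_mul_right (c := x⁻¹)).const_mul X
    simpa [div_eq_mul_inv] using h
  refine ⟨(intervalIntegrable_iff_integrableOn_Ioo_of_le hx.le).2
    (((intervalIntegrable_iff_integrableOn_Ioo_of_le hx.le).1 hΨx).congr_fun hEq
      measurableSet_Ioo), ?_⟩
  have hI : ∫ t in (0 : ℝ)..x, msmIntegrand α α' β β' γ
      (fun t : ℝ => (t : ℂ) ^ (ρ - 1) * besselW p b c (t : ℂ)) x t =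
        X * (x * ∫ y in Ioo 0 1, Ψ y) := by
    rw [intervalIntegral.integral_of_le hx.le, integral_Ioc_eq_integral_Ioo,
      ← setIntegral_congr_fun measurableSet_Ioo hEq, ← integral_Ioc_eq_integral_Ioo,
      ← intervalIntegral.integral_of_le hx.le, intervalIntegral.integral_const_mul,
      intervalIntegral.integral_comp_div _ hx.ne', zero_div, div_self hx.ne',
      intervalIntegral.integral_of_le zero_le_one, integral_Ioc_eq_integral_Ioo, Complex.real_smul]
  rw [msmIntegral, hI, ← hS.tsum_eq, ← hκ]
  have hs₁' : 0 < (ρ + p + γ - α - α' - β).re := by simp at hs₁ ⊢; linarith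
  have hs₂' : 0 < (ρ + p + β' - α').re := by simp at hs₂ ⊢; linarith
  have hterm : ∀ k : ℕ, (-1) ^ k * c ^ k / (Complex.Gamma (κ + k) * (k.factorial : ℂ)) *
      ((x : ℂ) / 2) ^ (2 * (k : ℂ) + p) * mellinValue α α' β β' γ (ρ + p + (2 * k : ℕ)) =
      ((x : ℂ) ^ p / (2 : ℂ) ^ p) * (Complex.Gamma κ)⁻¹ * mellinValue α α' β β' γ (ρ + p) *
      (([(ρ + p) / 2, (ρ + p + 1) / 2,
          (ρ + p + γ - α - α' - β) / 2, (ρ + p + γ - α - α' - β + 1) / 2,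
          (ρ + p + β' - α') / 2, (ρ + p + β' - α' + 1) / 2].map fun s => poch s k).prod /
        (([κ, (ρ + p + β') / 2, (ρ + p + β' + 1) / 2,
          (ρ + p + γ - α - α') / 2, (ρ + p + γ - α - α' + 1) / 2,
          (ρ + p + γ - α' - β) / 2, (ρ + p + γ - α' - β + 1) / 2].map fun s => poch s k).prod *
            poch 1 k) * (-(c * (x : ℂ) ^ 2) / 4) ^ k) := by
    intro k
    rw [mellinValue_add_two_mul hs hs₁' hs₂' h₁ h₂ h₃, div_two_cpow p k hx,
      Gamma_add_nat_eq_poch hκ0, poch_one,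
      show -(c * (x : ℂ) ^ 2) / 4 = -1 * c * ((x : ℂ) ^ 2 / 4) by ring, mul_pow, mul_pow]
    simp only [List.map_cons, List.map_nil, List.prod_cons, List.prod_nil, mul_one, div_eq_mul_inv,
      mul_inv]
    ring
  simp_rw [hterm]
  rw [tsum_mul_left, genHypergeometric]
  have hx0 : (x : ℂ) ≠ 0 := by exact_mod_cast hx.ne'
  have hpow : (x : ℂ) ^ (ρ + p - α - α' + γ - 1) = (x : ℂ) ^ (-α) * X * x * (x : ℂ) ^ p := by
    rw [hX]
    conv_rhs => enter [1, 2]; rw [← Complex.cpow_one (x : ℂ)]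
    simp only [← Complex.cpow_add _ _ hx0]
    congr 1
    ring
  rw [hpow]
  have hG : (Complex.Gamma γ)⁻¹ * Complex.Gamma γ = 1 :=
    inv_mul_cancel₀ (Complex.Gamma_ne_zero hγ')
  have hfin : ∀ T : ℂ, (x : ℂ) ^ (-α) / Complex.Gamma γ * (X * (x * ((x : ℂ) ^ p / (2 : ℂ) ^ p *
      (Complex.Gamma κ)⁻¹ * mellinValue α α' β β' γ (ρ + p) * T))) =
      (x : ℂ) ^ (-α) * X * x * (x : ℂ) ^ p / (2 : ℂ) ^ p *
          (Complex.Gamma (ρ + p) * Complex.Gamma (ρ + p + γ - α - α' - β) *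
              Complex.Gamma (ρ + p + β' - α') /
            (Complex.Gamma (ρ + p + β') * Complex.Gamma (ρ + p + γ - α - α') *
              Complex.Gamma (ρ + p + γ - α' - β) * Complex.Gamma κ)) * T := by
    intro T
    rw [mellinValue]
    simp only [div_eq_mul_inv, mul_inv]
    generalize (Complex.Gamma (ρ + p + β'))⁻¹ = g₁
    generalize (Complex.Gamma (ρ + p + γ - α - α'))⁻¹ = g₂
    generalize (Complex.Gamma (ρ + p + γ - α' - β))⁻¹ = g₃
    linear_combination (x : ℂ) ^ (-α) * X * x * (x : ℂ) ^ p * ((2 : ℂ) ^ p)⁻¹ *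
      (Complex.Gamma (ρ + p) * Complex.Gamma (ρ + p + γ - α - α' - β) *
        Complex.Gamma (ρ + p + β' - α') * (g₁ * g₂ * g₃ * (Complex.Gamma κ)⁻¹)) * T * hG
  exact hfin _
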